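/- Let $n\in\mathbb N$ and let $p:\mathbb R^n\to[1,\infty)$ be a measurable variable exponent; put $p^-:=\operatorname{ess\,inf}_{\mathbb R^n}p$ and $p^+:=\operatorname{ess\,sup}_{\mathbb R^n}p$. Assume that $1<p^-\le p^+<\infty$ and that $1/p$ is log-Hölder continuous, i.e. there is $L>0$ with $\left|\frac1{p(x)}-\frac1{p(y)}\right|\le \frac{L}{\log(e+1/|x-y|)}$ for all $x\neq y$ in $\mathbb R^n$. Let $\mathcal A:\mathbb R^n\times\mathbb R\times\mathbb R^n\to\mathbb R^n$ be a Carathéodory function ($x\mapsto\mathcal A(x,t,\xi)$ is measurable for all $(t,\xi)$, and $(t,\xi)\mapsto\mathcal A(x,t,\xi)$ is continuous for all $x$) of nonstandard growth: there are measurable functions $a\le b$ on $\mathbb R^n$ and constants $a_->0$, $b^+<\infty$ with $a\ge a_-$ and $b\le b^+$ such that for all $(x,t,\xi)\in\mathbb R^n\times\mathbb R\times\mathbb R^n$ $$\langle\mathcal A(x,t,\xi),\xi\rangle\ge a(x)|\xi|^{p(x)},\qquad |\mathcal A(x,t,\xi)|\le b(x)|\xi|^{p(x)-1}.$$ Let $u$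 be $\mathcal A$-harmonic in $\mathbb R^n$, that is, $u:\mathbb R^n\to\mathbb R$ is continuous, $u\in W^{1,p(\cdot)}_{loc}(\mathbb R^n)$ (on every compact set $K$, both $u$ and its distributional gradient $\nabla u$ belong to $L^{p(\cdot)}(K)$, the space of measurable $f$ with $\int_K|f(x)/\mu|^{p(x)}\,dx<\infty$ for some $\mu>0$), and $$\int_{\mathbb R^n}\langle\mathcal A(x,u,\nabla u),\nabla\phi\rangle\,dx=0\qquad\text{for all }\phi\in C_0^\infty(\mathbb R^n).$$ Let $C>0$, let $\alpha\in\mathbb R$ satisfy $$\alpha<\frac{p^-}{p^+}-\frac{n}{p^+},$$ and let $(R_k)$ be a nondecreasing unbounded sequence of radii. Suppose that there is an index $k_0$ with $R_{k_0}>1$ such that for all $k\ge k_0$ $$|u(x)|\le C|x|^\alpha\qquad\text{for all }x\in B_{2R_k}\setminus B_{R_k},$$ where $B_r=\{x\in\mathbb R^n:|x|<r\}$. Then $u$ is constant. -/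

import Mathlib

open MeasureTheory Set
open scoped ContDiff Gradient

/-- `C₀^∞(ℝⁿ)`: smooth compactly supported test functions. -/
structure IsTestFunction {n : ℕ} (φ : EuclideanSpace ℝ (Fin n) → ℝ) : Prop where
  smooth : ContDiff ℝ ∞ φ
  compactSupport : HasCompactSupport φ

/-- `α` is log-Hölder continuous on `ℝⁿ`: for some `L > 0`,
`|α(x) - α(y)| ≤ L / log (e + 1/|x-y|)` for all `x, y`.
(For `x = y` the left-hand side vanishes, so the convention `1/0 = 0` is harmless.) -/
def LogHolder {n : ℕ} (α : EuclideanSpace ℝ (Fin n) → ℝ) : Prop :=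
  ∃ L : ℝ, 0 < L ∧ ∀ x y, |α x - α y| ≤ L / Real.log (Real.exp 1 + 1 / ‖x - y‖)

/-- `p⁺`, the essential supremum of `p` over `ℝⁿ`. -/
noncomputable def expSup {n : ℕ} (p : EuclideanSpace ℝ (Fin n) → ℝ) : ℝ :=
  essSup p volume

/-- `p⁻`, the essential infimum of `p` over `ℝⁿ`. -/
noncomputable def expInf {n : ℕ} (p : EuclideanSpace ℝ (Fin n) → ℝ) : ℝ :=
  essInf p volume

/-- The standing class of exponents on `ℝⁿ`: variable exponents `p ≥ 1` with `1/p` log-Hölder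
continuous and `1 < p⁻ ≤ p⁺ < ∞`.  The bounds `one_le` and `bounded` make the real-valued essential
infimum and supremum meaningful. -/
structure IsLogHolderExponent {n : ℕ} (p : EuclideanSpace ℝ (Fin n) → ℝ) : Prop where
  measurable : Measurable p
  one_le : ∀ x, 1 ≤ p x
  logHolder : LogHolder fun x => 1 / p x
  bounded : ∃ M : ℝ, ∀ᵐ x, p x ≤ M
  one_lt_expInf : 1 < expInf p

/-- The modular `ϱ_{L^{p(·)}(S)}(f) = ∫_S |f(x)|^{p(x)} dx`, with values in `[0, ∞]`. -/
noncomputable def varModular {n : ℕ} {F : Type*} [NormedAddCommGroup F]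
    (p : EuclideanSpace ℝ (Fin n) → ℝ) (S : Set (EuclideanSpace ℝ (Fin n)))
    (f : EuclideanSpace ℝ (Fin n) → F) : ENNReal :=
  ∫⁻ x in S, ENNReal.ofReal (‖f x‖ ^ p x)

/-- `f ∈ L^{p(·)}(S)`: `f` is measurable and the modular of `f/μ` is finite for some `μ > 0`. -/
def MemVarLp {n : ℕ} {F : Type*} [NormedAddCommGroup F] [NormedSpace ℝ F]
    (p : EuclideanSpace ℝ (Fin n) → ℝ) (S : Set (EuclideanSpace ℝ (Fin n)))
    (f : EuclideanSpace ℝ (Fin n) → F) : Prop :=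
  AEStronglyMeasurable f (volume.restrict S) ∧
    ∃ μ : ℝ, 0 < μ ∧ varModular p S (fun x => μ⁻¹ • f x) < ⊤

/-- `g` is the distributional gradient of `u` on `ℝⁿ`:
`∫ u ∇φ = - ∫ φ g` for all test functions `φ`. -/
structure HasDistribGradient {n : ℕ} (u : EuclideanSpace ℝ (Fin n) → ℝ)
    (g : EuclideanSpace ℝ (Fin n) → EuclideanSpace ℝ (Fin n)) : Prop where
  locInt_fun : LocallyIntegrable u volume
  locInt_grad : LocallyIntegrable g volume
  integral_eq : ∀ φ : EuclideanSpace ℝ (Fin n) → ℝ, IsTestFunction φ →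
    ∫ x, u x • ∇ φ x = - ∫ x, φ x • g x

/-- `u ∈ W^{1,p(·)}_loc(ℝⁿ)` with distributional gradient `g`. -/
structure MemW1VarLoc {n : ℕ} (p : EuclideanSpace ℝ (Fin n) → ℝ)
    (u : EuclideanSpace ℝ (Fin n) → ℝ)
    (g : EuclideanSpace ℝ (Fin n) → EuclideanSpace ℝ (Fin n)) : Prop where
  grad : HasDistribGradient u g
  memLp_fun : ∀ K : Set (EuclideanSpace ℝ (Fin n)), IsCompact K → MemVarLp p K u
  memLp_grad : ∀ K : Set (EuclideanSpace ℝ (Fin n)), IsCompact K → MemVarLp p K g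

/-- `A(x, t, ξ)` is a Carathéodory function: (Lebesgue) measurable in `x`, continuous in `(t, ξ)`. -/
structure IsCaratheodory {n : ℕ}
    (A : EuclideanSpace ℝ (Fin n) → ℝ → EuclideanSpace ℝ (Fin n) → EuclideanSpace ℝ (Fin n)) :
    Prop where
  measurable : ∀ t ξ, AEMeasurable (fun x => A x t ξ) volume
  continuous : ∀ x, Continuous fun q : ℝ × EuclideanSpace ℝ (Fin n) => A x q.1 q.2

/-- `A` is a Carathéodory function of nonstandard growth (`p(·)`-growth): there are measurable
`a ≤ b`, with `a` bounded below by a positive constant and `b` bounded above, such that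
`⟨A(x,t,ξ), ξ⟩ ≥ a(x)|ξ|^{p(x)}` and `|A(x,t,ξ)| ≤ b(x)|ξ|^{p(x)-1}` for all `(x,t,ξ)`. -/
def HasNonstandardGrowth {n : ℕ} (p : EuclideanSpace ℝ (Fin n) → ℝ)
    (A : EuclideanSpace ℝ (Fin n) → ℝ → EuclideanSpace ℝ (Fin n) → EuclideanSpace ℝ (Fin n)) :
    Prop :=
  IsCaratheodory A ∧
  ∃ a b : EuclideanSpace ℝ (Fin n) → ℝ,
    AEMeasurable a volume ∧ AEMeasurable b volume ∧
    (∃ aMinus : ℝ, 0 < aMinus ∧ ∀ x, aMinus ≤ a x) ∧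
    (∃ bPlus : ℝ, ∀ x, b x ≤ bPlus) ∧
    (∀ x, a x ≤ b x) ∧
    (∀ x t ξ, a x * ‖ξ‖ ^ p x ≤ inner ℝ (A x t ξ) ξ) ∧
    (∀ x t ξ, ‖A x t ξ‖ ≤ b x * ‖ξ‖ ^ (p x - 1))

/-- `u` is `A`-harmonic in `ℝⁿ`: `u` is continuous, lies in `W^{1,p(·)}_loc(ℝⁿ)`, and
`∫ ⟨A(x, u, ∇u), ∇φ⟩ dx = 0` for every test function `φ`.  (Under `p(·)`-growth of `A` the
integrand is integrable for each `u ∈ W^{1,p(·)}_loc(ℝⁿ)`.) -/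
def IsAHarmonic {n : ℕ} (p : EuclideanSpace ℝ (Fin n) → ℝ)
    (A : EuclideanSpace ℝ (Fin n) → ℝ → EuclideanSpace ℝ (Fin n) → EuclideanSpace ℝ (Fin n))
    (u : EuclideanSpace ℝ (Fin n) → ℝ) : Prop :=
  Continuous u ∧
  ∃ g : EuclideanSpace ℝ (Fin n) → EuclideanSpace ℝ (Fin n),
    MemW1VarLoc p u g ∧
    ∀ φ : EuclideanSpace ℝ (Fin n) → ℝ, IsTestFunction φ →
      ∫ x, inner ℝ (A x (u x) (g x)) (∇ φ x) = 0

/-! Testing the equation with `η ^ (m + 1) * u ^ (2 * k + 1)`, `η` a cutoff between `B_R` and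
`B_{2R}`, gives a Caccioppoli inequality: `∫ η ^ (m + 1) * u ^ (2 * k) * |∇u| ^ p` is at most a
constant times `∫ u ^ (2 * k) * (|u| |∇η|) ^ p`. Only the annulus contributes on the right. There
`|u| |∇η|` is of order `R ^ (α - 1)`, which is small because `α < 1`, so the exponent may be
replaced by `p⁻` and the right side is of order `R ^ (2kα + (α - 1) p⁻ + n)`. For `α ≥ 0` the
hypothesis makes this exponent negative with `k = 0`; for `α < 0` a large `k` does. Letting `R → ∞`
gives `u ^ (2 * k) * |∇u| ^ p = 0` a.e.; hence `u ^ (2 * k + 1)` has zero gradient and is constant,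
and so is `u`.

The delicate point is that this test function is only Sobolev. It is mollified, and log-Hölder
continuity yields `|ρ_j * G| ^ p ≤ C (1 + ρ_j * |G| ^ p)` with `C` independent of `j`
(`exists_norm_mollify_rpow_le`). The right side converges a.e. with constant integrals of its last
term, so dominated convergence with moving majorants passes to the limit
(`HasDistribGradient.integral_inner_eq_zero`). -/

open Filter Topology Metric
open scoped Convolution

/-! ### Moving majorants and mollification. -/

section Mollification

/-- Dominated convergence with converging dominating functions. -/
theorem tendsto_integral_of_tendsto_dominating {X V : Type*} [MeasurableSpace X] {μ : Measure X}
    [NormedAddCommGroup V] [NormedSpace ℝ V] {F : ℕ → X → V} {f : X → V} {h : ℕ → X → ℝ}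
    {H : X → ℝ} (hF : ∀ j, AEStronglyMeasurable (F j) μ) (hh : ∀ j, Integrable (h j) μ)
    (hH : Integrable H μ) (hle : ∀ j, ∀ᵐ x ∂μ, ‖F j x‖ ≤ h j x)
    (hFlim : ∀ᵐ x ∂μ, Tendsto (fun j => F j x) atTop (𝓝 (f x)))
    (hhlim : ∀ᵐ x ∂μ, Tendsto (fun j => h j x) atTop (𝓝 (H x)))
    (hint : Tendsto (fun j => ∫ x, h j x ∂μ) atTop (𝓝 (∫ x, H x ∂μ))) :
    Integrable f μ ∧ Tendsto (fun j => ∫ x, F j x ∂μ) atTop (𝓝 (∫ x, f x ∂μ)) := by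
  have hle' : ∀ᵐ x ∂μ, ∀ j, ‖F j x‖ ≤ h j x := ae_all_iff.2 hle
  have hfm : AEStronglyMeasurable f μ := aestronglyMeasurable_of_tendsto_ae atTop hF hFlim
  have hfH : ∀ᵐ x ∂μ, ‖f x‖ ≤ H x := by
    filter_upwards [hle', hFlim, hhlim] with x h1 h2 h3
    exact le_of_tendsto_of_tendsto' h2.norm h3 h1
  have hfi : Integrable f μ := hH.mono' hfm hfH
  have hFi : ∀ j, Integrable (F j) μ := fun j => (hh j).mono' (hF j) (hle j)
  have hpos : Tendsto (fun j => ∫ x, max (H x - h j x) 0 ∂μ) atTop (𝓝 (∫ _, (0 : ℝ) ∂μ)) := by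
    refine tendsto_integral_of_dominated_convergence H
      (fun j => ((hH.sub (hh j)).pos_part).aestronglyMeasurable) hH (fun j => ?_) ?_
    · filter_upwards [hle j, hfH] with x h1 h2
      have h3 := (norm_nonneg _).trans h1
      have h4 := (norm_nonneg _).trans h2
      rw [Real.norm_of_nonneg (le_max_right _ _)]
      exact max_le (by linarith) h4
    · filter_upwards [hhlim] with x hx
      simpa using (hx.const_sub (H x)).max (tendsto_const_nhds (x := (0 : ℝ)))
  -- `|h - H| = 2 (H - h)⁺ + (h - H)`: the first term is dominated by `2H`, the second is controlled
  -- by the convergence of integrals.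
  have hL1 : Tendsto (fun j => ∫ x, |h j x - H x| ∂μ) atTop (𝓝 0) := by
    have e : ∀ j, ∫ x, |h j x - H x| ∂μ
        = 2 * ∫ x, max (H x - h j x) 0 ∂μ + (∫ x, h j x ∂μ - ∫ x, H x ∂μ) := by
      intro j
      have hp : Integrable (fun x => 2 * max (H x - h j x) 0) μ :=
        ((hH.sub (hh j)).pos_part).const_mul 2
      have hs : Integrable (fun x => h j x - H x) μ := (hh j).sub hH
      rw [← integral_sub (hh j) hH, ← integral_const_mul, ← integral_add hp hs]
      refine integral_congr_ae (Eventually.of_forall fun x => ?_)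
      rcases le_total (h j x) (H x) with h1 | h1
      · simp only [abs_of_nonpos (sub_nonpos.2 h1), max_eq_left (sub_nonneg.2 h1)]; ring
      · simp only [abs_of_nonneg (sub_nonneg.2 h1), max_eq_right (sub_nonpos.2 h1)]; ring
    simp_rw [e]
    simpa using (hpos.const_mul 2).add (hint.sub_const (∫ x, H x ∂μ))
  -- `‖F j - f‖ ≤ h j + H ≤ |h j - H| + 2H`, so this excess has the fixed majorant `2H`.
  have hmax : Tendsto (fun j => ∫ x, max (‖F j x - f x‖ - |h j x - H x|) 0 ∂μ) atTop
      (𝓝 (∫ _, (0 : ℝ) ∂μ)) := by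
    refine tendsto_integral_of_dominated_convergence (fun x => 2 * H x)
      (fun j => ((((hFi j).sub hfi).norm.sub ((hh j).sub hH).abs).pos_part).aestronglyMeasurable)
      (hH.const_mul 2) (fun j => ?_) ?_
    · filter_upwards [hle j, hfH] with x h1 h2
      have h4 := (norm_nonneg _).trans h2
      rw [Real.norm_of_nonneg (le_max_right _ _)]
      refine max_le ?_ (by linarith)
      linarith [norm_sub_le (F j x) (f x), le_abs_self (h j x - H x)]
    · filter_upwards [hFlim, hhlim] with x hx hx'
      have h1 : Tendsto (fun j => ‖F j x - f x‖) atTop (𝓝 0) := by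
        simpa using (hx.sub_const (f x)).norm
      have h2 : Tendsto (fun j => |h j x - H x|) atTop (𝓝 0) := by
        simpa using (hx'.sub_const (H x)).abs
      simpa using (h1.sub h2).max (tendsto_const_nhds (x := (0 : ℝ)))
  refine ⟨hfi, ?_⟩
  rw [tendsto_iff_norm_sub_tendsto_zero]
  refine squeeze_zero (fun _ => norm_nonneg _) (fun j => ?_)
    (by simpa using hmax.add hL1 : Tendsto (fun j => ∫ x, max (‖F j x - f x‖ - |h j x - H x|) 0 ∂μ
      + ∫ x, |h j x - H x| ∂μ) atTop (𝓝 0))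
  have ha : Integrable (fun x => |h j x - H x|) μ := ((hh j).sub hH).abs
  have hn : Integrable (fun x => ‖F j x - f x‖) μ := ((hFi j).sub hfi).norm
  have hm : Integrable (fun x => max (‖F j x - f x‖ - |h j x - H x|) 0) μ := (hn.sub ha).pos_part
  rw [← integral_sub (hFi j) hfi, ← integral_add hm ha]
  refine (norm_integral_le_integral_norm _).trans (integral_mono hn (hm.add ha) fun x => ?_)
  have := le_max_left (‖F j x - f x‖ - |h j x - H x|) 0
  simp only
  linarith

variable {n : ℕ}

local notation "𝔼" => EuclideanSpace ℝ (Fin n)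

variable {V : Type*} [NormedAddCommGroup V] [NormedSpace ℝ V]

/-- A sequence of bump functions centred at the origin with supports shrinking to a point. -/
noncomputable def mollifier (n : ℕ) (j : ℕ) : ContDiffBump (0 : EuclideanSpace ℝ (Fin n)) where
  rIn := 1 / (2 * ((j : ℝ) + 1))
  rOut := 1 / ((j : ℝ) + 1)
  rIn_pos := by positivity
  rIn_lt_rOut := by
    have : (0 : ℝ) < (j : ℝ) + 1 := by positivity
    exact one_div_lt_one_div_of_lt this (by linarith)

/-- The standard mollification of `f` at scale `1 / (j + 1)`. -/
noncomputable def mollify (j : ℕ) (f : 𝔼 → V) : 𝔼 → V :=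
  (mollifier n j).normed volume ⋆[ContinuousLinearMap.lsmul ℝ ℝ, volume] f

theorem mollifier_rOut_le_one (j : ℕ) : (mollifier n j).rOut ≤ 1 := by
  have : (0 : ℝ) ≤ j := j.cast_nonneg
  exact (div_le_one (by positivity)).2 (by linarith)

theorem tendsto_mollifier_rOut : Tendsto (fun j => (mollifier n j).rOut) atTop (𝓝 0) :=
  tendsto_one_div_add_atTop_nhds_zero_nat

theorem mollify_apply (j : ℕ) (f : 𝔼 → V) (x : 𝔼) :
    mollify j f x = ∫ t, (mollifier n j).normed volume t • f (x - t) := rfl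

/-- Lebesgue differentiation applies because the outer radius is a fixed multiple of the inner one.
-/
theorem ae_tendsto_mollify [CompleteSpace V] {f : 𝔼 → V} (hf : LocallyIntegrable f volume) :
    ∀ᵐ x, Tendsto (fun j => mollify j f x) atTop (𝓝 (f x)) := by
  refine ContDiffBump.ae_convolution_tendsto_right_of_locallyIntegrable (K := 2)
    tendsto_mollifier_rOut (Eventually.of_forall fun j => le_of_eq ?_) hf
  have : ((j : ℝ) + 1) ≠ 0 := by positivity
  simp only [mollifier]
  field_simp

theorem tendsto_mollify [CompleteSpace V] {f : 𝔼 → V} (hf : Continuous f) (x : 𝔼) :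
    Tendsto (fun j => mollify j f x) atTop (𝓝 (f x)) :=
  ContDiffBump.convolution_tendsto_right_of_continuous tendsto_mollifier_rOut hf x

theorem integrable_mollify_integrand {f : 𝔼 → V} (hf : LocallyIntegrable f volume) (j : ℕ)
    (x : 𝔼) : Integrable fun t => (mollifier n j).normed volume t • f (x - t) :=
  (mollifier n j).hasCompactSupport_normed.convolutionExists_left (ContinuousLinearMap.lsmul ℝ ℝ)
    (mollifier n j).continuous_normed hf x

theorem contDiff_mollify {f : 𝔼 → V} (hf : LocallyIntegrable f volume) (j : ℕ) :
    ContDiff ℝ ∞ (mollify j f) :=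
  (mollifier n j).hasCompactSupport_normed.contDiff_convolution_left _
    (mollifier n j).contDiff_normed hf

theorem norm_mollify_le {f : 𝔼 → V} (j : ℕ) (x : 𝔼) :
    ‖mollify j f x‖ ≤ mollify j (fun y => ‖f y‖) x := by
  rw [mollify_apply, mollify_apply]
  refine (norm_integral_le_integral_norm _).trans (le_of_eq ?_)
  simp [norm_smul, abs_of_nonneg ((mollifier n j).nonneg_normed _)]

theorem integrable_mollify {f : 𝔼 → V} (hf : Integrable f volume) (j : ℕ) :
    Integrable (mollify j f) volume :=
  (mollifier n j).integrable_normed.integrable_convolution _ hf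

theorem integral_mollify [CompleteSpace V] {f : 𝔼 → V} (hf : Integrable f volume) (j : ℕ) :
    ∫ x, mollify j f x = ∫ x, f x := by
  rw [mollify, integral_convolution _ (mollifier n j).integrable_normed hf,
    (mollifier n j).integral_normed]
  simp

/-- All mollifiers live in the unit ball, which gives locality at a scale independent of `j`. -/
theorem mollify_congr_of_ball {f g : 𝔼 → V} {j : ℕ} {x : 𝔼}
    (h : ∀ y ∈ ball x 1, f y = g y) : mollify j f x = mollify j g x := by
  rw [mollify_apply, mollify_apply]
  congr 1 with t
  by_cases ht : t ∈ Function.support ((mollifier n j).normed volume)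
  · rw [ContDiffBump.support_normed_eq, mem_ball_zero_iff] at ht
    rw [h (x - t) (by simpa [mem_ball, dist_eq_norm] using ht.trans_le (mollifier_rOut_le_one j))]
  · simp [Function.notMem_support.1 ht]

theorem mollify_eq_zero_of_closedBall {f : 𝔼 → V} {r : ℝ}
    (h : ∀ y, y ∉ closedBall (0 : 𝔼) r → f y = 0) {j : ℕ} {x : 𝔼}
    (hx : x ∉ closedBall (0 : 𝔼) (r + 1)) : mollify j f x = 0 := by
  rw [mollify_congr_of_ball (g := fun _ => 0), mollify_apply]
  · simp
  · intro y hy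
    refine h y fun hy' => hx ?_
    rw [mem_closedBall_zero_iff] at hy' ⊢
    rw [mem_ball, dist_comm, dist_eq_norm] at hy
    have := norm_add_le (x - y) y
    rw [sub_add_cancel] at this
    linarith

theorem exists_norm_mollify_le [CompleteSpace V] {f : 𝔼 → V} (hf : Continuous f) (r : ℝ) :
    ∃ K : ℝ, ∀ j, ∀ x ∈ closedBall (0 : 𝔼) r, ‖mollify j f x‖ ≤ K := by
  obtain ⟨K, hK⟩ := (isCompact_closedBall (0 : 𝔼) (r + 1)).exists_bound_of_continuousOn
    hf.continuousOn
  refine ⟨2 * K + K, fun j x hx => ?_⟩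
  have hball : ∀ y ∈ ball x (1 : ℝ), ‖f y‖ ≤ K := fun y hy => by
    refine hK y ?_
    rw [mem_closedBall_zero_iff] at hx ⊢
    rw [mem_ball, dist_eq_norm] at hy
    have := norm_add_le (y - x) x
    rw [sub_add_cancel] at this
    linarith
  have hxK := hball x (mem_ball_self one_pos)
  have := (mollifier n j).dist_normed_convolution_le (μ := volume) (x₀ := x) (ε := 2 * K)
    hf.aestronglyMeasurable fun y hy => by
      rw [dist_eq_norm]
      have := hball y (ball_subset_ball (mollifier_rOut_le_one j) hy)
      linarith [norm_sub_le (f y) (f x)]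
  rw [dist_eq_norm] at this
  have h2 := norm_add_le (mollify j f x - f x) (f x)
  rw [sub_add_cancel] at h2
  refine h2.trans (add_le_add this hxK)

end Mollification

/-! ### Calculus of distributional gradients. -/

section DistribGradient

variable {n : ℕ}

local notation "𝔼" => EuclideanSpace ℝ (Fin n)

theorem gradient_mul {f g : 𝔼 → ℝ} {x : 𝔼} (hf : DifferentiableAt ℝ f x)
    (hg : DifferentiableAt ℝ g x) :
    ∇ (fun y => f y * g y) x = f x • ∇ g x + g x • ∇ f x := by
  refine ext_inner_right ℝ fun y => ?_
  rw [inner_add_left, real_inner_smul_left, real_inner_smul_left, inner_gradient_left,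
    inner_gradient_left, inner_gradient_left, fderiv_fun_mul hf hg]
  simp

theorem ContDiff.continuous_gradient {f : 𝔼 → ℝ} (hf : ContDiff ℝ ∞ f) : Continuous (∇ f) :=
  (InnerProductSpace.toDual ℝ 𝔼).symm.continuous.comp (hf.continuous_fderiv (by simp))

theorem gradient_eq_zero_of_notMem_tsupport {f : 𝔼 → ℝ} {x : 𝔼} (hx : x ∉ tsupport f) :
    ∇ f x = 0 := by
  refine ext_inner_right ℝ fun y => ?_
  rw [inner_gradient_left, fderiv_of_notMem_tsupport ℝ hx]
  simp

theorem HasCompactSupport.gradient {f : 𝔼 → ℝ} (hf : HasCompactSupport f) :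
    HasCompactSupport (∇ f) :=
  HasCompactSupport.of_support_subset_isCompact hf fun _ hx => by
    by_contra h
    exact hx (gradient_eq_zero_of_notMem_tsupport h)

theorem IsTestFunction.smooth_mul {ψ φ : 𝔼 → ℝ} (hψ : ContDiff ℝ ∞ ψ) (hφ : IsTestFunction φ) :
    IsTestFunction fun x => ψ x * φ x :=
  ⟨hψ.mul hφ.smooth, hφ.compactSupport.mul_left⟩

/-- The derivative falls on the kernel, and `t ↦ ρ (x - t)` is itself a test function; the sign from
reflecting the kernel cancels the one from integrating by parts. -/
theorem HasDistribGradient.hasGradientAt_mollify {v : 𝔼 → ℝ} {G : 𝔼 → 𝔼}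
    (h : HasDistribGradient v G) (j : ℕ) (x : 𝔼) :
    HasGradientAt (mollify j v) (mollify j G x) x := by
  set ρ := (mollifier n j).normed volume with hρ
  have hρs : ContDiff ℝ ∞ ρ := (mollifier n j).contDiff_normed
  have hρc : HasCompactSupport ρ := (mollifier n j).hasCompactSupport_normed
  have hd := hρc.hasFDerivAt_convolution_left (ContinuousLinearMap.lsmul ℝ ℝ) (μ := volume)
    (hρs.of_le (by simp)) h.locInt_fun x
  rw [hasGradientAt_iff_hasFDerivAt]
  refine hd.congr_fderiv ?_
  have hsub : ∀ t, HasFDerivAt (fun t => ρ (x - t)) (-(fderiv ℝ ρ (x - t))) t := fun t => by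
    have h1 : HasFDerivAt (fun t : 𝔼 => x - t) (-(ContinuousLinearMap.id ℝ 𝔼)) t :=
      (hasFDerivAt_id t).const_sub x
    have h2 := ((hρs.differentiable (by simp)) (x - t)).hasFDerivAt.comp t h1
    rw [show (-(fderiv ℝ ρ (x - t))) = (fderiv ℝ ρ (x - t)).comp (-(ContinuousLinearMap.id ℝ 𝔼)) by
      ext; simp]
    exact h2
  have hgrad : ∀ t, ∇ (fun t => ρ (x - t)) t = -∇ ρ (x - t) := fun t => by
    refine ext_inner_right ℝ fun y => ?_
    rw [inner_neg_left, inner_gradient_left, inner_gradient_left, (hsub t).fderiv]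
    simp
  have htest : IsTestFunction fun t => ρ (x - t) :=
    ⟨hρs.comp (contDiff_const.sub contDiff_id),
      hρc.comp_homeomorph (Homeomorph.subLeft x)⟩
  have hint := h.integral_eq _ htest
  simp_rw [hgrad, smul_neg, integral_neg, neg_inj] at hint
  have hG : mollify j G x = ∫ t, v t • ∇ ρ (x - t) := by
    rw [hint, mollify, convolution_eq_swap]
    rfl
  have hconv : (fderiv ℝ ρ ⋆[(ContinuousLinearMap.lsmul ℝ ℝ).precompL 𝔼, volume] v) x
      = ∫ t, ((ContinuousLinearMap.lsmul ℝ ℝ).precompL 𝔼) (fderiv ℝ ρ (x - t)) (v t) :=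
    convolution_eq_swap _
  have hexists : Integrable fun t =>
      ((ContinuousLinearMap.lsmul ℝ ℝ : ℝ →L[ℝ] ℝ →L[ℝ] ℝ).precompL 𝔼) (fderiv ℝ ρ (x - t)) (v t) :=
    ((hρc.fderiv ℝ).convolutionExists_left _ (hρs.continuous_fderiv (by simp))
      h.locInt_fun x).integrable_swap
  have hint2 : Integrable fun t => v t • ∇ ρ (x - t) := by
    refine h.locInt_fun.integrable_smul_right_of_hasCompactSupport
      (hρs.continuous_gradient.comp (continuous_const.sub continuous_id)) ?_
    exact hρc.gradient.comp_homeomorph (Homeomorph.subLeft x)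
  ext y
  rw [hconv, ContinuousLinearMap.integral_apply hexists, InnerProductSpace.toDual_apply_apply, hG,
    ← real_inner_comm, ← integral_inner hint2]
  refine integral_congr_ae (Eventually.of_forall fun t => ?_)
  simp only [real_inner_smul_right, inner_gradient_right]
  simp [ContinuousLinearMap.precompL_apply, mul_comm]

/-- Test the gradient of `v` against `ψ * φ`; the terms with `∇ ψ` cancel. -/
theorem HasDistribGradient.smooth_mul {ψ v : 𝔼 → ℝ} {G : 𝔼 → 𝔼} (h : HasDistribGradient v G)
    (hψ : ContDiff ℝ ∞ ψ) :
    HasDistribGradient (fun x => ψ x * v x) (fun x => ψ x • G x + v x • ∇ ψ x) where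
  locInt_fun := h.locInt_fun.continuous_smul hψ.continuous
  locInt_grad := (h.locInt_grad.continuous_smul hψ.continuous).add
    (h.locInt_fun.smul_continuous hψ.continuous_gradient)
  integral_eq φ hφ := by
    have key := h.integral_eq _ (hφ.smooth_mul hψ)
    have hφg := hφ.compactSupport.gradient
    have i1 : Integrable fun x => (ψ x * v x) • ∇ φ x := by
      have := h.locInt_fun.integrable_smul_right_of_hasCompactSupport
        (hψ.continuous.smul hφ.smooth.continuous_gradient) hφg.smul_left
      refine this.congr (Eventually.of_forall fun x => ?_)
      simp only [Pi.smul_apply', smul_smul, mul_comm]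
    have i2 : Integrable fun x => (φ x * v x) • ∇ ψ x := by
      have := h.locInt_fun.integrable_smul_right_of_hasCompactSupport
        (hφ.smooth.continuous.smul hψ.continuous_gradient) hφ.compactSupport.smul_right
      refine this.congr (Eventually.of_forall fun x => ?_)
      simp only [Pi.smul_apply', smul_smul, mul_comm]
    have i3 : Integrable fun x => (ψ x * φ x) • G x :=
      h.locInt_grad.integrable_smul_left_of_hasCompactSupport
        (hψ.continuous.mul hφ.smooth.continuous) hφ.compactSupport.mul_left
    have e1 : ∫ x, v x • ∇ (fun x => ψ x * φ x) x
        = (∫ x, (ψ x * v x) • ∇ φ x) + ∫ x, (φ x * v x) • ∇ ψ x := by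
      rw [← integral_add i1 i2]
      refine integral_congr_ae (Eventually.of_forall fun x => ?_)
      simp only
      rw [gradient_mul (hψ.differentiable (by simp) x) (hφ.smooth.differentiable (by simp) x)]
      simp only [smul_add, smul_smul, mul_comm]
    have e2 : ∫ x, φ x • (ψ x • G x + v x • ∇ ψ x)
        = (∫ x, (ψ x * φ x) • G x) + ∫ x, (φ x * v x) • ∇ ψ x := by
      rw [← integral_add i3 i2]
      refine integral_congr_ae (Eventually.of_forall fun x => ?_)
      simp only [smul_add, smul_smul, mul_comm]
    rw [e2, neg_add, ← key, e1, add_neg_cancel_right]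

/-- Mollifying `u` alone reduces to a smooth factor. In the limit, continuity of `u` bounds its
mollifications locally, and continuity of `v` leaves only the `L¹` convergence of the mollified
gradient. -/
theorem HasDistribGradient.mul {u v : 𝔼 → ℝ} {g G : 𝔼 → 𝔼} (hu : HasDistribGradient u g)
    (hv : HasDistribGradient v G) (huc : Continuous u) (hvc : Continuous v) :
    HasDistribGradient (fun x => u x * v x) (fun x => u x • G x + v x • g x) where
  locInt_fun := hv.locInt_fun.continuous_smul huc
  locInt_grad := (hv.locInt_grad.continuous_smul huc).add (hu.locInt_grad.continuous_smul hvc)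
  integral_eq φ hφ := by
    have happ : ∀ j, ∫ x, (mollify j u x * v x) • ∇ φ x
        = -(∫ x, φ x • (mollify j u x • G x + v x • mollify j g x)) := fun j => by
      have := (hv.smooth_mul (contDiff_mollify hu.locInt_fun j)).integral_eq φ hφ
      simpa only [(hu.hasGradientAt_mollify j _).gradient] using this
    obtain ⟨r, hr⟩ := hφ.compactSupport.isCompact.isBounded.subset_closedBall (0 : 𝔼)
    have hφ0 : ∀ x, x ∉ closedBall (0 : 𝔼) r → φ x = 0 := fun x hx =>
      image_eq_zero_of_notMem_tsupport fun h => hx (hr h)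
    obtain ⟨K, hK⟩ := exists_norm_mollify_le huc r
    have hmc : ∀ j, Continuous (mollify j u) := fun j =>
      (contDiff_mollify hu.locInt_fun j).continuous
    have i1 : Integrable fun x => v x • ∇ φ x :=
      hv.locInt_fun.integrable_smul_right_of_hasCompactSupport hφ.smooth.continuous_gradient
        hφ.compactSupport.gradient
    have i2 : Integrable fun x => φ x • G x :=
      hv.locInt_grad.integrable_smul_left_of_hasCompactSupport hφ.smooth.continuous
        hφ.compactSupport
    have t1 : Tendsto (fun j => ∫ x, (mollify j u x * v x) • ∇ φ x) atTop
        (𝓝 (∫ x, (u x * v x) • ∇ φ x)) := by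
      refine tendsto_integral_of_dominated_convergence (fun x => K * ‖v x • ∇ φ x‖)
        (fun j => (((hmc j).mul hvc).smul hφ.smooth.continuous_gradient).aestronglyMeasurable)
        (i1.norm.const_mul K) (fun j => Eventually.of_forall fun x => ?_)
        (Eventually.of_forall fun x => ?_)
      · by_cases hx : x ∈ closedBall (0 : 𝔼) r
        · rw [mul_smul, norm_smul]
          exact mul_le_mul_of_nonneg_right (hK j x hx) (norm_nonneg _)
        · rw [gradient_eq_zero_of_notMem_tsupport fun h => hx (hr h)]
          simp
      · exact ((tendsto_mollify huc x).mul_const _).smul_const _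
    have t2 : Tendsto (fun j => ∫ x, mollify j u x • φ x • G x) atTop
        (𝓝 (∫ x, u x • φ x • G x)) := by
      refine tendsto_integral_of_dominated_convergence (fun x => K * ‖φ x • G x‖)
        (fun j => (hmc j).aestronglyMeasurable.smul i2.aestronglyMeasurable)
        (i2.norm.const_mul K) (fun j => Eventually.of_forall fun x => ?_)
        (Eventually.of_forall fun x => ?_)
      · by_cases hx : x ∈ closedBall (0 : 𝔼) r
        · rw [norm_smul]
          exact mul_le_mul_of_nonneg_right (hK j x hx) (norm_nonneg _)
        · simp [hφ0 x hx]
      · exact (tendsto_mollify huc x).smul_const _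
    obtain ⟨M, hM⟩ := hφ.compactSupport.mul_right (f' := v) |>.exists_bound_of_continuous
      (hφ.smooth.continuous.mul hvc)
    have hM0 : 0 ≤ M := (norm_nonneg _).trans (hM 0)
    -- Truncation makes `g` globally integrable, so the majorants `mollify j ‖w‖` have constant
    -- integral; the extra unit of radius leaves the mollifications unchanged on the support of `φ`.
    set w : 𝔼 → 𝔼 := (closedBall (0 : 𝔼) (r + 1)).indicator g with hw
    have hwi : Integrable w :=
      (hu.locInt_grad.integrableOn_isCompact (isCompact_closedBall _ _)).integrable_indicator
        measurableSet_closedBall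
    have hgc : ∀ j, Continuous (mollify j g) := fun j =>
      (contDiff_mollify hu.locInt_grad j).continuous
    have i3 : ∀ j, Integrable fun x => (φ x * v x) • mollify j g x := fun j =>
      (((hφ.smooth.continuous.mul hvc).smul (hgc j))).integrable_of_hasCompactSupport
        (hφ.compactSupport.mul_right.smul_right)
    have t3 : Tendsto (fun j => ∫ x, (φ x * v x) • mollify j g x) atTop
        (𝓝 (∫ x, (φ x * v x) • g x)) := by
      refine (tendsto_integral_of_tendsto_dominating
        (h := fun j x => M * mollify j (fun y => ‖w y‖) x)
        (H := fun x => M * ‖w x‖) (fun j => (i3 j).aestronglyMeasurable)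
        (fun j => (integrable_mollify hwi.norm j).const_mul M) (hwi.norm.const_mul M)
        (fun j => Eventually.of_forall fun x => ?_) ?_ ?_ ?_).2
      · by_cases hx : x ∈ closedBall (0 : 𝔼) r
        · rw [norm_smul]
          refine mul_le_mul (hM x) ?_ (norm_nonneg _) hM0
          rw [mollify_congr_of_ball (g := w)]
          · exact norm_mollify_le j x
          · intro y hy
            rw [hw, indicator_of_mem]
            rw [mem_closedBall_zero_iff] at hx ⊢
            rw [mem_ball, dist_eq_norm] at hy
            have := norm_add_le (y - x) x
            rw [sub_add_cancel] at this
            linarith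
        · rw [hφ0 x hx, zero_mul, zero_smul, norm_zero]
          exact mul_nonneg hM0 (integral_nonneg fun t =>
            mul_nonneg ((mollifier n j).nonneg_normed t) (norm_nonneg _))
      · filter_upwards [ae_tendsto_mollify hu.locInt_grad] with x hx
        exact hx.const_smul _
      · filter_upwards [ae_tendsto_mollify hwi.norm.locallyIntegrable] with x hx
        exact hx.const_mul _
      · simp_rw [integral_const_mul, integral_mollify hwi.norm]
        exact tendsto_const_nhds
    have hsplit : ∀ j, ∫ x, φ x • (mollify j u x • G x + v x • mollify j g x)
        = (∫ x, mollify j u x • φ x • G x) + ∫ x, (φ x * v x) • mollify j g x := fun j => by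
      rw [← integral_add _ (i3 j)]
      · refine integral_congr_ae (Eventually.of_forall fun x => ?_)
        simp only [smul_add, smul_smul, mul_comm]
      · have := hv.locInt_grad.integrable_smul_left_of_hasCompactSupport
          ((hmc j).mul hφ.smooth.continuous) hφ.compactSupport.mul_left
        simpa only [smul_smul, Pi.mul_apply] using this
    have hsplit' : ∫ x, φ x • (u x • G x + v x • g x)
        = (∫ x, u x • φ x • G x) + ∫ x, (φ x * v x) • g x := by
      rw [← integral_add]
      · refine integral_congr_ae (Eventually.of_forall fun x => ?_)
        simp only [smul_add, smul_smul, mul_comm]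
      · have := hv.locInt_grad.integrable_smul_left_of_hasCompactSupport
          (huc.mul hφ.smooth.continuous) hφ.compactSupport.mul_left
        simpa only [smul_smul, Pi.mul_apply] using this
      · exact hu.locInt_grad.integrable_smul_left_of_hasCompactSupport
          (hφ.smooth.continuous.mul hvc) hφ.compactSupport.mul_right
    rw [hsplit']
    refine tendsto_nhds_unique t1 ?_
    simp_rw [happ, hsplit]
    exact (t2.add t3).neg

theorem HasDistribGradient.congr_right {u : 𝔼 → ℝ} {g g' : 𝔼 → 𝔼} (h : HasDistribGradient u g)
    (hg : g =ᵐ[volume] g') : HasDistribGradient u g' where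
  locInt_fun := h.locInt_fun
  locInt_grad := h.locInt_grad.congr hg
  integral_eq φ hφ := by
    rw [h.integral_eq φ hφ]
    congr 1
    refine integral_congr_ae ?_
    filter_upwards [hg] with x hx
    rw [hx]

theorem HasDistribGradient.pow {u : 𝔼 → ℝ} {g : 𝔼 → 𝔼} (h : HasDistribGradient u g)
    (hu : Continuous u) (k : ℕ) :
    HasDistribGradient (fun x => u x ^ (k + 1)) (fun x => ((k + 1 : ℝ) * u x ^ k) • g x) := by
  induction k with
  | zero => simpa using h
  | succ k ih =>
    convert h.mul ih hu (hu.pow _) using 2 with x x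
    · ring
    · rw [smul_smul, ← add_smul]
      congr 1
      push_cast
      ring

/-- Each mollification has zero gradient, hence is constant, and they converge pointwise. -/
theorem HasDistribGradient.eq_const_of_eq_zero {u : 𝔼 → ℝ} {g : 𝔼 → 𝔼}
    (h : HasDistribGradient u g) (hu : Continuous u) (hg : g =ᵐ[volume] 0) (x y : 𝔼) :
    u x = u y := by
  have h' := h.congr_right hg
  have hc : ∀ j, mollify j u x = mollify j u y := fun j => by
    refine is_const_of_fderiv_eq_zero (𝕜 := ℝ)
      ((contDiff_mollify h.locInt_fun j).differentiable (by simp)) (fun z => ?_) x y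
    have := (h'.hasGradientAt_mollify j z).hasFDerivAt.fderiv
    rw [this, mollify_apply]
    simp
  refine tendsto_nhds_unique (tendsto_mollify hu x) ?_
  simp_rw [hc]
  exact tendsto_mollify hu y

end DistribGradient

/-! ### Variable exponents: pointwise mollifier bound and Sobolev test functions. -/

section VariableExponent

variable {n : ℕ}

local notation "𝔼" => EuclideanSpace ℝ (Fin n)

/-- Young's inequality without sharp constants: according to whether `y ≤ δ * x`, one term on the
right suffices. -/
theorem Real.rpow_sub_one_mul_le {x y δ P : ℝ} (hx : 0 ≤ x) (hy : 0 ≤ y) (hδ : 0 < δ)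
    (hP : 1 ≤ P) : x ^ (P - 1) * y ≤ δ * x ^ P + δ ^ (1 - P) * y ^ P := by
  have key : ∀ z : ℝ, 0 < z → z ^ (P - 1) * z = z ^ P := fun z hz => by
    rw [Real.rpow_sub_one hz.ne', div_mul_cancel₀ _ hz.ne']
  have h1 : 0 ≤ δ * x ^ P := by positivity
  have h2 : 0 ≤ δ ^ (1 - P) * y ^ P := by positivity
  rcases hy.eq_or_lt with rfl | hy'
  · simpa using add_nonneg h1 h2
  rcases le_or_gt y (δ * x) with h | h
  · have hx' : 0 < x := by
      by_contra hx'
      have : x = 0 := le_antisymm (not_lt.1 hx') hx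
      subst this
      linarith
    calc x ^ (P - 1) * y ≤ x ^ (P - 1) * (δ * x) := by gcongr
      _ = δ * (x ^ (P - 1) * x) := by ring
      _ = δ * x ^ P := by rw [key x hx']
      _ ≤ _ := by linarith
  · have hxy : x ≤ y / δ := by rw [le_div_iff₀ hδ]; linarith
    calc x ^ (P - 1) * y ≤ (y / δ) ^ (P - 1) * y := by
          have := Real.rpow_le_rpow hx hxy (by linarith : 0 ≤ P - 1)
          gcongr
      _ = δ ^ (1 - P) * (y ^ (P - 1) * y) := by
          rw [Real.div_rpow hy hδ.le, show 1 - P = -(P - 1) by ring, Real.rpow_neg hδ.le]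
          ring
      _ = δ ^ (1 - P) * y ^ P := by rw [key y hy']
      _ ≤ _ := by linarith

/-- Above the level `l`, `s = s ^ (1 - q) * s ^ q ≤ l ^ (1 - q) * s ^ P`. This replaces Jensen's
inequality when the exponent varies. -/
theorem Real.le_add_rpow_mul_one_add_rpow {s l q P : ℝ} (hs : 0 ≤ s) (hl : 1 ≤ l) (hq : 1 ≤ q)
    (hqP : q ≤ P) : s ≤ l + l ^ (1 - q) * (1 + s ^ P) := by
  have hl0 : 0 < l := by linarith
  have h1 : 0 ≤ l ^ (1 - q) := by positivity
  have h2 : 0 ≤ s ^ P := by positivity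
  rcases le_or_gt s l with h | h
  · nlinarith
  · have hs0 : 0 < s := hl0.trans h
    have : s = s ^ (1 - q) * s ^ q := by
      rw [← Real.rpow_add hs0]; simp
    have h3 : s ^ (1 - q) ≤ l ^ (1 - q) :=
      Real.rpow_le_rpow_of_nonpos hl0 h.le (by linarith)
    have h4 : s ^ q ≤ s ^ P := Real.rpow_le_rpow_of_exponent_le (by linarith) hqP
    calc s = s ^ (1 - q) * s ^ q := this
      _ ≤ l ^ (1 - q) * s ^ P := by gcongr
      _ ≤ _ := by nlinarith

/-- The growth is only polynomial in `j`, so its logarithm can be offset by the log-Hölder modulus.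
-/
theorem mollify_le_mul_integral {h : 𝔼 → ℝ} (hi : Integrable h) (h0 : ∀ x, 0 ≤ h x) :
    ∃ K : ℝ, 0 ≤ K ∧ ∀ j x, mollify j h x ≤ K * ((j : ℝ) + 1) ^ n := by
  set κ := volume.real (closedBall (0 : 𝔼) 1) with hκ
  have hκ0 : 0 < κ :=
    ENNReal.toReal_pos (measure_closedBall_pos _ _ one_pos).ne' measure_closedBall_lt_top.ne
  have hI : 0 ≤ ∫ x, h x := integral_nonneg h0
  refine ⟨2 ^ n / κ * ∫ x, h x, by positivity, fun j x => ?_⟩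
  have hb : ∀ t, (mollifier n j).normed volume t ≤ 2 ^ n / κ * ((j : ℝ) + 1) ^ n := fun t => by
    refine ((mollifier n j).normed_le_div_measure_closedBall_rIn volume t).trans (le_of_eq ?_)
    rw [Measure.addHaar_real_closedBall' _ _ (mollifier n j).rIn_pos.le, ← hκ]
    have : ((j : ℝ) + 1) ≠ 0 := by positivity
    simp only [mollifier, finrank_euclideanSpace, Fintype.card_fin]
    rw [show (1 / (2 * ((j : ℝ) + 1))) = 2⁻¹ * ((j : ℝ) + 1)⁻¹ by field_simp, mul_pow, inv_pow,
      inv_pow]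
    field_simp
  calc mollify j h x ≤ ∫ t, (2 ^ n / κ * ((j : ℝ) + 1) ^ n) * h (x - t) := by
        rw [mollify_apply]
        refine integral_mono (integrable_mollify_integrand hi.locallyIntegrable j x)
          ((hi.comp_sub_left x).const_mul _) fun t => ?_
        exact mul_le_mul_of_nonneg_right (hb t) (h0 _)
    _ = _ := by
        rw [integral_const_mul, integral_sub_left_eq_self (fun y => h y)]
        ring

/-- On the support ball around `x`, `1 / p` exceeds its value at `x` by at most `δ = L / ℓ`.
Splitting at a level gives a bound by `(1 + S) ^ (1 + δ * M)`, and `(1 + S) ^ (δ * M)` stays bounded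
since `log (1 + S)` is at most a multiple of `ℓ`. -/
theorem exists_norm_mollify_rpow_le {p : 𝔼 → ℝ} (hp1 : ∀ x, 1 ≤ p x)
    (hL : LogHolder fun x => 1 / p x) (M : ℝ) {G : 𝔼 → 𝔼} (hG : LocallyIntegrable G)
    (hGp : Integrable fun x => ‖G x‖ ^ p x) :
    ∃ C : ℝ, 0 ≤ C ∧ ∀ j x, p x ≤ M →
      ‖mollify j G x‖ ^ p x ≤ C * (1 + mollify j (fun y => ‖G y‖ ^ p y) x) := by
  obtain ⟨L, hL0, hL⟩ := hL
  have hnn : ∀ x, 0 ≤ ‖G x‖ ^ p x := fun x => by positivity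
  obtain ⟨K, hK0, hK⟩ := mollify_le_mul_integral hGp hnn
  refine ⟨2 ^ M * Real.exp ((Real.log (1 + K) + n) * L * M), by positivity, fun j x hx => ?_⟩
  set S := mollify j (fun y => ‖G y‖ ^ p y) x with hS
  set T := mollify j (fun y => ‖G y‖) x with hT
  have hφ0 : ∀ t, 0 ≤ (mollifier n j).normed volume t := (mollifier n j).nonneg_normed
  have hS0 : 0 ≤ S := integral_nonneg fun t => mul_nonneg (hφ0 t) (hnn _)
  have hj : (0 : ℝ) < (j : ℝ) + 1 := by positivity
  set ℓ := Real.log (Real.exp 1 + 1 / (mollifier n j).rOut) with hℓ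
  have hrO : 1 / (mollifier n j).rOut = (j : ℝ) + 1 := by simp [mollifier]
  have hℓ1 : 1 ≤ ℓ := by
    rw [hℓ, Real.le_log_iff_exp_le (by rw [hrO]; positivity), hrO]
    linarith
  set δ := L / ℓ with hδ
  have hδ0 : 0 < δ := by positivity
  have hpx : 0 < p x := by linarith [hp1 x]
  -- `r` bounds `1 / p` from above on the ball, so `r⁻¹` is an exponent below `p` there; the minimum
  -- keeps it at least 1.
  set r := min 1 (1 / p x + δ) with hr
  have hr0 : 0 < r := lt_min one_pos (by positivity)
  have hr1 : r ≤ 1 := min_le_left _ _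
  have hq1 : 1 ≤ r⁻¹ := (one_le_inv₀ hr0).2 hr1
  have hq : ∀ t, ‖t‖ < (mollifier n j).rOut → r⁻¹ ≤ p (x - t) := fun t ht => by
    have hpt : 0 < p (x - t) := by linarith [hp1 (x - t)]
    rw [inv_le_comm₀ hr0 hpt]
    refine le_min (inv_le_one_of_one_le₀ (hp1 _)) ?_
    rcases eq_or_ne t 0 with rfl | ht0
    · simpa using hδ0.le
    have ht0' : 0 < ‖t‖ := norm_pos_iff.2 ht0
    have h1 := hL (x - t) x
    have h2 : ℓ ≤ Real.log (Real.exp 1 + 1 / ‖x - t - x‖) := by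
      rw [sub_sub_cancel_left, norm_neg]
      refine Real.log_le_log (by rw [hrO]; positivity) ?_
      gcongr
    have h3 : L / Real.log (Real.exp 1 + 1 / ‖x - t - x‖) ≤ δ := by
      rw [hδ]
      gcongr
    have := (le_abs_self _).trans h1
    simp only [one_div] at this ⊢
    simp only [one_div] at h3
    linarith
  -- This level balances the two terms: `l ^ (1 - r⁻¹) * (1 + S) = l`.
  set l := (1 + S) ^ r with hl
  have hl1 : 1 ≤ l := Real.one_le_rpow (by linarith) hr0.le
  have hl0 : 0 < l := by linarith
  have hlS : l ^ (1 - r⁻¹) * (1 + S) = l := by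
    have : (1 + S) = l ^ r⁻¹ := by
      rw [hl, ← Real.rpow_mul (by linarith), mul_inv_cancel₀ hr0.ne', Real.rpow_one]
    nth_rw 1 [this]
    rw [← Real.rpow_add hl0]
    simp
  have hiφ : Integrable fun t => (mollifier n j).normed volume t :=
    (mollifier n j).integrable_normed
  have hiS : Integrable fun t =>
      (mollifier n j).normed volume t * (‖G (x - t)‖ ^ p (x - t)) :=
    integrable_mollify_integrand hGp.locallyIntegrable j x
  have hGn : LocallyIntegrable fun y => ‖G y‖ := fun y =>
    let ⟨s, hs, h⟩ := hG y
    ⟨s, hs, h.norm⟩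
  have hiSum : Integrable fun t => (mollifier n j).normed volume t +
      (mollifier n j).normed volume t * (‖G (x - t)‖ ^ p (x - t)) := hiφ.add hiS
  have hTl : T ≤ 2 * l := by
    calc T ≤ ∫ t, (l * (mollifier n j).normed volume t + l ^ (1 - r⁻¹) *
          ((mollifier n j).normed volume t +
            (mollifier n j).normed volume t * (‖G (x - t)‖ ^ p (x - t)))) := by
          rw [hT, mollify_apply]
          refine integral_mono (integrable_mollify_integrand hGn j x)
            ((hiφ.const_mul l).add (hiSum.const_mul _)) fun t => ?_
          by_cases ht : t ∈ Function.support ((mollifier n j).normed volume)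
          · rw [ContDiffBump.support_normed_eq, mem_ball_zero_iff] at ht
            have := mul_le_mul_of_nonneg_left (Real.le_add_rpow_mul_one_add_rpow
              (norm_nonneg (G (x - t))) hl1 hq1 (hq t ht)) (hφ0 t)
            simp only [smul_eq_mul]
            linarith
          · simp [Function.notMem_support.1 ht]
      _ = l + l ^ (1 - r⁻¹) * (1 + S) := by
          rw [integral_add (hiφ.const_mul l) (hiSum.const_mul _), integral_const_mul,
            integral_const_mul, integral_add hiφ hiS, (mollifier n j).integral_normed, mul_one]
          rfl
      _ = 2 * l := by rw [hlS]; ring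
  have hlog : Real.log (1 + S) ≤ (Real.log (1 + K) + n) * ℓ := by
    have h1 : 1 + S ≤ (1 + K) * ((j : ℝ) + 1) ^ n := by
      have : (1 : ℝ) ≤ ((j : ℝ) + 1) ^ n :=
        one_le_pow₀ (by linarith [(Nat.cast_nonneg j : (0 : ℝ) ≤ j)])
      linarith [hK j x]
    have h2 : Real.log ((j : ℝ) + 1) ≤ ℓ := by
      rw [hℓ, hrO]
      exact Real.log_le_log hj (by linarith [Real.exp_pos 1])
    have h3 : 0 ≤ Real.log (1 + K) := Real.log_nonneg (by linarith)
    calc Real.log (1 + S) ≤ Real.log ((1 + K) * ((j : ℝ) + 1) ^ n) :=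
          Real.log_le_log (by linarith) h1
      _ = Real.log (1 + K) + n * Real.log ((j : ℝ) + 1) := by
          rw [Real.log_mul (by linarith) (by positivity), Real.log_pow]
      _ ≤ Real.log (1 + K) * ℓ + n * ℓ := by
          gcongr
          nlinarith
      _ = _ := by ring
  have hM0 : 0 ≤ M := hpx.le.trans hx
  have hpow : (1 + S) ^ (δ * M) ≤ Real.exp ((Real.log (1 + K) + n) * L * M) := by
    rw [Real.rpow_def_of_pos (by linarith)]
    refine Real.exp_le_exp.2 ?_
    calc Real.log (1 + S) * (δ * M) ≤ (Real.log (1 + K) + n) * ℓ * (δ * M) := by gcongr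
      _ = (Real.log (1 + K) + n) * (δ * ℓ) * M := by ring
      _ = _ := by rw [hδ, div_mul_cancel₀ _ (by linarith)]
  calc ‖mollify j G x‖ ^ p x ≤ (2 * l) ^ p x :=
        Real.rpow_le_rpow (norm_nonneg _) ((norm_mollify_le j x).trans hTl) hpx.le
    _ = 2 ^ p x * (1 + S) ^ (r * p x) := by
        rw [Real.mul_rpow (by norm_num) hl0.le, hl, ← Real.rpow_mul (by linarith)]
    _ ≤ 2 ^ M * (1 + S) ^ (1 + δ * M) := by
        gcongr
        · norm_num
        · linarith
        · calc r * p x ≤ (1 / p x + δ) * p x := by gcongr; exact min_le_right _ _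
            _ = 1 + δ * p x := by field_simp
            _ ≤ 1 + δ * M := by gcongr
    _ = 2 ^ M * (1 + S) ^ (δ * M) * (1 + S) := by
        rw [Real.rpow_add (by linarith), Real.rpow_one]; ring
    _ ≤ _ := by gcongr

/-- Boundedness of `p` allows the scaling `μ` to be removed at the cost of a constant. -/
theorem MemVarLp.integrableOn_rpow {p : 𝔼 → ℝ} (hpm : Measurable p) (hp1 : ∀ x, 1 ≤ p x) {M : ℝ}
    (hM : ∀ᵐ x, p x ≤ M) {K : Set 𝔼} {g : 𝔼 → 𝔼} (h : MemVarLp p K g) :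
    IntegrableOn (fun x => ‖g x‖ ^ p x) K := by
  obtain ⟨hg, μ, hμ, hfin⟩ := h
  have hint : IntegrableOn (fun x => ‖μ⁻¹ • g x‖ ^ p x) K := by
    refine ⟨?_, ?_⟩
    · exact ((hg.const_smul μ⁻¹).norm.aemeasurable.pow hpm.aemeasurable).aestronglyMeasurable
    · rw [hasFiniteIntegral_iff_ofReal (Eventually.of_forall fun x => by positivity)]
      exact hfin
  refine (hint.const_mul (max 1 μ ^ M)).mono'
    (hg.norm.aemeasurable.pow hpm.aemeasurable).aestronglyMeasurable ?_
  filter_upwards [ae_restrict_of_ae hM] with x hx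
  have hp0 : 0 ≤ p x := by linarith [hp1 x]
  rw [Real.norm_of_nonneg (by positivity)]
  have e : ‖g x‖ = μ * ‖μ⁻¹ • g x‖ := by
    rw [norm_smul, norm_inv, Real.norm_of_nonneg hμ.le, mul_inv_cancel_left₀ hμ.ne']
  rw [e, Real.mul_rpow hμ.le (norm_nonneg _)]
  gcongr
  calc μ ^ p x ≤ max 1 μ ^ p x := Real.rpow_le_rpow hμ.le (le_max_right _ _) hp0
    _ ≤ max 1 μ ^ M := Real.rpow_le_rpow_of_exponent_le (le_max_left _ _) hx

/-- For simple arguments the composition is a finite sum of measurable pieces; continuity in `(t,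
ξ)` passes to the limit. -/
theorem IsCaratheodory.aestronglyMeasurable_comp {A : 𝔼 → ℝ → 𝔼 → 𝔼} (hA : IsCaratheodory A)
    {u : 𝔼 → ℝ} {g : 𝔼 → 𝔼} (hu : AEStronglyMeasurable u) (hg : AEStronglyMeasurable g) :
    AEStronglyMeasurable fun x => A x (u x) (g x) := by
  have hq : AEStronglyMeasurable (fun x => (u x, g x)) := hu.prodMk hg
  set q := hq.mk _ with hqdef
  have hqm : StronglyMeasurable q := hq.stronglyMeasurable_mk
  have hs : ∀ s : SimpleFunc 𝔼 (ℝ × 𝔼), AEStronglyMeasurable fun x => A x (s x).1 (s x).2 := by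
    intro s
    have e : (fun x => A x (s x).1 (s x).2)
        = fun x => ∑ y ∈ s.range, (s ⁻¹' {y}).indicator (fun x => A x y.1 y.2) x := by
      ext1 x
      rw [Finset.sum_eq_single (s x)]
      · simp
      · intro y _ hy
        exact indicator_of_notMem (fun h => hy (by simpa using h.symm)) _
      · intro h
        exact absurd (s.mem_range_self x) h
    rw [e]
    exact Finset.aestronglyMeasurable_fun_sum _ fun y _ =>
      (hA.measurable y.1 y.2).aestronglyMeasurable.indicator (s.measurableSet_fiber y)
  have hlim : AEStronglyMeasurable fun x => A x (q x).1 (q x).2 := by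
    refine aestronglyMeasurable_of_tendsto_ae atTop (fun j => hs (hqm.approx j))
      (Eventually.of_forall fun x => ?_)
    exact ((hA.continuous x).tendsto (q x)).comp (hqm.tendsto_approx x)
  refine hlim.congr ?_
  filter_upwards [hq.ae_eq_mk] with x hx
  rw [hqdef, ← hx]

/-- A weakly divergence-free field of `p(·)`-growth can be tested with compactly supported
Sobolev functions. -/
theorem HasDistribGradient.integral_inner_eq_zero {p : 𝔼 → ℝ} (hp1 : ∀ x, 1 ≤ p x)
    (hL : LogHolder fun x => 1 / p x) {M : ℝ} (hM : ∀ᵐ x, p x ≤ M) {F g : 𝔼 → 𝔼}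
    (hF : AEStronglyMeasurable F) {b : ℝ} (hb : 0 ≤ b)
    (hFg : ∀ x, ‖F x‖ ≤ b * ‖g x‖ ^ (p x - 1))
    (hgp : ∀ r, IntegrableOn (fun x => ‖g x‖ ^ p x) (closedBall 0 r))
    (htest : ∀ φ : 𝔼 → ℝ, IsTestFunction φ → ∫ x, inner ℝ (F x) (∇ φ x) = 0)
    {v : 𝔼 → ℝ} {G : 𝔼 → 𝔼} (hv : HasDistribGradient v G) {r : ℝ}
    (hv0 : ∀ x, x ∉ closedBall (0 : 𝔼) r → v x = 0)
    (hG0 : ∀ x, x ∉ closedBall (0 : 𝔼) r → G x = 0)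
    (hGp : Integrable fun x => ‖G x‖ ^ p x) :
    Integrable (fun x => inner ℝ (F x) (G x)) ∧ ∫ x, inner ℝ (F x) (G x) = 0 := by
  obtain ⟨C, hC0, hC⟩ := exists_norm_mollify_rpow_le hp1 hL M hv.locInt_grad hGp
  set B := closedBall (0 : 𝔼) (r + 1) with hB
  have hBm : MeasurableSet B := measurableSet_closedBall
  have hφ : ∀ j, IsTestFunction (mollify j v) := fun j =>
    ⟨contDiff_mollify hv.locInt_fun j, HasCompactSupport.intro (isCompact_closedBall 0 (r + 1))
      fun x hx => mollify_eq_zero_of_closedBall hv0 hx⟩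
  have hzero : ∀ j, ∫ x, inner ℝ (F x) (mollify j G x) = 0 := fun j => by
    have := htest _ (hφ j)
    simpa only [(hv.hasGradientAt_mollify j _).gradient] using this
  have hi1 : Integrable (B.indicator fun x => b * (‖g x‖ ^ p x + C)) := by
    refine IntegrableOn.integrable_indicator ?_ hBm
    exact ((hgp (r + 1)).add (integrableOn_const (measure_closedBall_lt_top.ne))).const_mul b
  have hi2 : ∀ j, Integrable fun x => b * C * mollify j (fun y => ‖G y‖ ^ p y) x := fun j =>
    (integrable_mollify hGp j).const_mul _
  have hi3 : Integrable fun x => b * C * (‖G x‖ ^ p x) := hGp.const_mul _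
  -- Young with `δ = 1` and the mollifier bound give the majorant. Only its second term depends on
  -- `j`, and that term has constant integral.
  have key := tendsto_integral_of_tendsto_dominating
    (F := fun j x => inner ℝ (F x) (mollify j G x)) (f := fun x => inner ℝ (F x) (G x))
    (h := fun j x => B.indicator (fun x => b * (‖g x‖ ^ p x + C)) x
      + b * C * mollify j (fun y => ‖G y‖ ^ p y) x)
    (H := fun x => B.indicator (fun x => b * (‖g x‖ ^ p x + C)) x + b * C * (‖G x‖ ^ p x))
    (fun j => hF.inner (contDiff_mollify hv.locInt_grad j).continuous.aestronglyMeasurable)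
    (fun j => hi1.add (hi2 j)) (hi1.add hi3) (fun j => ?_) ?_ ?_ ?_
  · refine ⟨key.1, tendsto_nhds_unique key.2 ?_⟩
    simp_rw [hzero]
    exact tendsto_const_nhds
  · filter_upwards [hM] with x hx
    have hm0 : 0 ≤ mollify j (fun y => ‖G y‖ ^ p y) x := integral_nonneg fun t =>
      mul_nonneg ((mollifier n j).nonneg_normed t) (by positivity)
    by_cases hxB : x ∈ B
    · rw [indicator_of_mem hxB]
      have hy := Real.rpow_sub_one_mul_le (norm_nonneg (g x)) (norm_nonneg (mollify j G x))
        one_pos (hp1 x)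
      rw [Real.one_rpow, one_mul, one_mul] at hy
      calc ‖inner ℝ (F x) (mollify j G x)‖ ≤ ‖F x‖ * ‖mollify j G x‖ := norm_inner_le_norm _ _
        _ ≤ b * ‖g x‖ ^ (p x - 1) * ‖mollify j G x‖ := by gcongr; exact hFg x
        _ = b * (‖g x‖ ^ (p x - 1) * ‖mollify j G x‖) := by ring
        _ ≤ b * (‖g x‖ ^ p x + C * (1 + mollify j (fun y => ‖G y‖ ^ p y) x)) := by
          gcongr
          exact hy.trans (by linarith [hC j x hx])
        _ = _ := by ring
    · rw [indicator_of_notMem hxB, mollify_eq_zero_of_closedBall hG0 hxB, inner_zero_right,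
        norm_zero]
      positivity
  · filter_upwards [ae_tendsto_mollify hv.locInt_grad] with x hx
    exact tendsto_const_nhds.inner hx
  · filter_upwards [ae_tendsto_mollify hGp.locallyIntegrable] with x hx
    exact (hx.const_mul _).const_add _
  · simp_rw [fun j => integral_add hi1 (hi2 j), integral_add hi1 hi3, integral_const_mul,
      integral_mollify hGp]
    exact tendsto_const_nhds

end VariableExponent

/-! ### Caccioppoli inequality, cutoffs and growth. -/

section Liouville

variable {n : ℕ}

local notation "𝔼" => EuclideanSpace ℝ (Fin n)

theorem gradient_pow_succ {f : 𝔼 → ℝ} {x : 𝔼} (hf : DifferentiableAt ℝ f x) (m : ℕ) :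
    ∇ (fun y => f y ^ (m + 1)) x = ((m + 1 : ℝ) * f x ^ m) • ∇ f x := by
  refine ext_inner_right ℝ fun y => ?_
  rw [real_inner_smul_left, inner_gradient_left, inner_gradient_left, fderiv_fun_pow _ hf]
  simp

/-- Young applied to `t ^ e * x` with `e * P = m + 1`; since `e ≥ 1` and `t ≤ 1`, `t ^ m ≤ t ^ (e *
(P - 1))`. Thus a cutoff to a power at least `p` keeps the weight needed for absorption. -/
theorem Real.pow_mul_rpow_sub_one_mul_le {t x y δ P : ℝ} {m : ℕ} (ht : 0 ≤ t) (ht1 : t ≤ 1)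
    (hx : 0 ≤ x) (hy : 0 ≤ y) (hδ : 0 < δ) (hP : 1 ≤ P) (hPm : P ≤ m + 1) :
    t ^ m * (x ^ (P - 1) * y) ≤ δ * (t ^ (m + 1) * x ^ P) + δ ^ (1 - P) * y ^ P := by
  have hP0 : 0 < P := by linarith
  set e : ℝ := (m + 1) / P with he
  have heP : e * P = m + 1 := by rw [he]; field_simp
  have he1 : 1 ≤ e := (one_le_div hP0).2 hPm
  have h := Real.rpow_sub_one_mul_le (x := t ^ e * x) (by positivity) hy hδ hP
  rw [Real.mul_rpow (by positivity) hx, Real.mul_rpow (by positivity) hx, ← Real.rpow_mul ht,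
    ← Real.rpow_mul ht, heP] at h
  have h1 : t ^ m ≤ t ^ (e * (P - 1)) := by
    rw [← Real.rpow_natCast]
    refine Real.rpow_le_rpow_of_exponent_ge' ht ht1 (mul_nonneg (by linarith) (by linarith)) ?_
    rw [mul_sub, heP]
    linarith
  have h2 : t ^ ((m : ℝ) + 1) = t ^ (m + 1) := by
    rw [← Real.rpow_natCast t (m + 1)]
    push_cast
    rfl
  rw [h2] at h
  calc t ^ m * (x ^ (P - 1) * y) ≤ t ^ (e * (P - 1)) * (x ^ (P - 1) * y) := by gcongr
    _ = t ^ (e * (P - 1)) * x ^ (P - 1) * y := by ring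
    _ ≤ _ := h
    _ = _ := by ring

theorem integrable_of_norm_le_indicator_closedBall {f : 𝔼 → ℝ} {h : 𝔼 → ℝ} {r : ℝ}
    (hf : AEStronglyMeasurable f) (hh : IntegrableOn h (closedBall 0 r))
    (h0 : ∀ x, x ∉ closedBall (0 : 𝔼) r → f x = 0)
    (hle : ∀ᵐ x, x ∈ closedBall (0 : 𝔼) r → ‖f x‖ ≤ h x) : Integrable f := by
  refine (hh.integrable_indicator measurableSet_closedBall).mono' hf ?_
  filter_upwards [hle] with x hx
  by_cases hxr : x ∈ closedBall (0 : 𝔼) r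
  · rw [indicator_of_mem hxr]
    exact hx hxr
  · rw [indicator_of_notMem hxr, h0 x hxr, norm_zero]

theorem Real.rpow_le_max_one_rpow {x P M : ℝ} (hx : 0 ≤ x) (hP : 0 ≤ P) (hPM : P ≤ M) :
    x ^ P ≤ max 1 x ^ M :=
  (Real.rpow_le_rpow hx (le_max_right _ _) hP).trans
    (Real.rpow_le_rpow_of_exponent_le (le_max_left _ _) hPM)

theorem integrable_pow_mul_rpow {p : 𝔼 → ℝ} (hpm : Measurable p) (hp1 : ∀ x, 1 ≤ p x) {M : ℝ}
    (hM : ∀ᵐ x, p x ≤ M) {u : 𝔼 → ℝ} (hu : Continuous u) {η : 𝔼 → ℝ} (hη : ContDiff ℝ ∞ η) {r : ℝ}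
    (hη0 : ∀ x, x ∉ closedBall (0 : 𝔼) r → ∇ η x = 0) (k : ℕ) :
    Integrable fun x => u x ^ (2 * k) * (|u x| * ‖∇ η x‖) ^ p x := by
  have hc : Continuous fun x => |u x| * ‖∇ η x‖ := hu.abs.mul hη.continuous_gradient.norm
  obtain ⟨K, hK⟩ := (isCompact_closedBall (0 : 𝔼) r).exists_bound_of_continuousOn hc.continuousOn
  obtain ⟨K', hK'⟩ := (isCompact_closedBall (0 : 𝔼) r).exists_bound_of_continuousOn
    (hu.pow (2 * k)).continuousOn
  refine integrable_of_norm_le_indicator_closedBall (h := fun _ => K' * max 1 K ^ M) (r := r)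
    ((hu.pow _).aestronglyMeasurable.mul
      (hc.aemeasurable.pow hpm.aemeasurable).aestronglyMeasurable)
    (integrableOn_const (measure_closedBall_lt_top.ne)) (fun x hx => ?_) ?_
  · have : p x ≠ 0 := by linarith [hp1 x]
    simp [hη0 x hx, Real.zero_rpow this]
  · filter_upwards [hM] with x hx hxr
    have h0 : 0 ≤ |u x| * ‖∇ η x‖ := by positivity
    have h1 := hK x hxr
    rw [Real.norm_of_nonneg h0] at h1
    have hp0 : 0 ≤ p x := by linarith [hp1 x]
    rw [norm_mul, Real.norm_of_nonneg (Real.rpow_nonneg h0 _)]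
    refine mul_le_mul (hK' x hxr) ?_ (by positivity) ((norm_nonneg _).trans (hK' x hxr))
    exact (Real.rpow_le_rpow h0 h1 hp0).trans
      (Real.rpow_le_max_one_rpow (h0.trans h1) hp0 hx)

/-- Caccioppoli inequality for powers of an `A`-harmonic function. -/
theorem exists_integral_pow_mul_rpow_le {p : 𝔼 → ℝ} (hpm : Measurable p) (hp1 : ∀ x, 1 ≤ p x)
    (hL : LogHolder fun x => 1 / p x) {M : ℝ} (hM : ∀ᵐ x, p x ≤ M) {F g : 𝔼 → 𝔼}
    (hF : AEStronglyMeasurable F) {a b : ℝ} (ha : 0 < a) (hb : 0 < b)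
    (hFa : ∀ x, a * ‖g x‖ ^ p x ≤ inner ℝ (F x) (g x))
    (hFb : ∀ x, ‖F x‖ ≤ b * ‖g x‖ ^ (p x - 1))
    (hgp : LocallyIntegrable fun x => ‖g x‖ ^ p x)
    (htest : ∀ φ : 𝔼 → ℝ, IsTestFunction φ → ∫ x, inner ℝ (F x) (∇ φ x) = 0)
    {u : 𝔼 → ℝ} (huc : Continuous u) (hu : HasDistribGradient u g) (k : ℕ) :
    ∃ K : ℝ, 0 < K ∧ ∃ m : ℕ, ∀ (η : 𝔼 → ℝ) (r : ℝ), ContDiff ℝ ∞ η → (∀ x, 0 ≤ η x) →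
      (∀ x, η x ≤ 1) → tsupport η ⊆ closedBall (0 : 𝔼) r →
      Integrable (fun x => η x ^ (m + 1) * (u x ^ (2 * k) * ‖g x‖ ^ p x)) ∧
      ∫ x, η x ^ (m + 1) * (u x ^ (2 * k) * ‖g x‖ ^ p x) ≤
        K * ∫ x, u x ^ (2 * k) * (|u x| * ‖∇ η x‖) ^ p x := by
  obtain ⟨m, hm⟩ := exists_nat_ge M
  -- Half of the coercive term absorbs the Young term; `D` bounds `δ ^ (1 - p x)` uniformly.
  set δ := a / (2 * (b * (m + 1))) with hδ
  have hδ0 : 0 < δ := by positivity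
  have hδb : b * (m + 1) * δ = a / 2 := by rw [hδ]; field_simp
  set D := max 1 δ⁻¹ ^ M with hD
  have hD0 : 0 < D := by positivity
  refine ⟨2 / a * (b * (m + 1) * D), by positivity, m, fun η r hη hη0 hη1 hηr => ?_⟩
  have hηz : ∀ x, x ∉ closedBall (0 : 𝔼) r → η x = 0 := fun x hx =>
    image_eq_zero_of_notMem_tsupport fun h => hx (hηr h)
  have hgz : ∀ x, x ∉ closedBall (0 : 𝔼) r → ∇ η x = 0 := fun x hx =>
    gradient_eq_zero_of_notMem_tsupport fun h => hx (hηr h)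
  have hWi : Integrable fun x => η x ^ (m + 1) * (u x ^ (2 * k) * ‖g x‖ ^ p x) := by
    have := hgp.integrable_smul_left_of_hasCompactSupport
      (g := fun x => η x ^ (m + 1) * u x ^ (2 * k))
      ((hη.continuous.pow _).mul (huc.pow _))
      (HasCompactSupport.mul_right (HasCompactSupport.intro (isCompact_closedBall 0 r)
        fun x hx => by rw [hηz x hx, zero_pow m.succ_ne_zero]))
    simpa only [smul_eq_mul, mul_assoc] using this
  have hYi := integrable_pow_mul_rpow hpm hp1 hM huc hη hgz k
  refine ⟨hWi, ?_⟩
  -- The odd power of `u` gives its gradient the nonnegative weight `u ^ (2 * k)`.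
  have hv := (hu.pow huc (2 * k)).smooth_mul (hη.pow (m + 1))
  have hgrad : ∀ x, ∇ (fun y => η y ^ (m + 1)) x = ((m + 1 : ℝ) * η x ^ m) • ∇ η x := fun x =>
    gradient_pow_succ (hη.differentiable (by simp) x) m
  simp only [hgrad] at hv
  set G : 𝔼 → 𝔼 := fun x => η x ^ (m + 1) • ((((2 * k : ℕ) : ℝ) + 1) * u x ^ (2 * k)) • g x
    + u x ^ (2 * k + 1) • ((m + 1 : ℝ) * η x ^ m) • ∇ η x with hG
  have hG0 : ∀ x, x ∉ closedBall (0 : 𝔼) r → G x = 0 := fun x hx => by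
    simp [hG, hηz x hx, hgz x hx]
  have hGp : Integrable fun x => ‖G x‖ ^ p x := by
    obtain ⟨c₁, hc₁⟩ := (isCompact_closedBall (0 : 𝔼) r).exists_bound_of_continuousOn
      (f := fun x => η x ^ (m + 1) * ((((2 * k : ℕ) : ℝ) + 1) * u x ^ (2 * k)))
      ((hη.continuous.pow _).mul ((huc.pow _).const_mul _)).continuousOn
    obtain ⟨c₂, hc₂⟩ := (isCompact_closedBall (0 : 𝔼) r).exists_bound_of_continuousOn
      (f := fun x => u x ^ (2 * k + 1) • ((m + 1 : ℝ) * η x ^ m) • ∇ η x)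
      ((huc.pow _).smul (((hη.continuous.pow _).const_mul _).smul
        hη.continuous_gradient)).continuousOn
    set c := max c₁ c₂ with hc
    refine integrable_of_norm_le_indicator_closedBall
      (h := fun x => max 1 (2 * c) ^ M * (‖g x‖ ^ p x + 1)) (r := r)
      ((hv.locInt_grad.aestronglyMeasurable.norm.aemeasurable.pow
        hpm.aemeasurable).aestronglyMeasurable)
      (((hgp.integrableOn_isCompact (isCompact_closedBall _ _)).add
        (integrableOn_const (measure_closedBall_lt_top.ne))).const_mul _) (fun x hx => ?_) ?_
    · have : p x ≠ 0 := by linarith [hp1 x]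
      simp only [hG0 x hx, norm_zero, Real.zero_rpow this]
    · filter_upwards [hM] with x hx hxr
      have hp0 : 0 ≤ p x := by linarith [hp1 x]
      have h1 := hc₁ x hxr
      have h2 := hc₂ x hxr
      have hc0 : 0 ≤ c := ((norm_nonneg _).trans h1).trans (le_max_left _ _)
      have hmax : 0 ≤ max ‖g x‖ 1 := by positivity
      have h3 : ‖G x‖ ≤ 2 * c * max ‖g x‖ 1 := by
        calc ‖G x‖ ≤ c₁ * ‖g x‖ + c₂ := by
              refine (norm_add_le _ _).trans (add_le_add ?_ h2)
              rw [smul_smul, norm_smul]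
              gcongr
          _ ≤ c * max ‖g x‖ 1 + c * max ‖g x‖ 1 := by
              have e1 : c₁ * ‖g x‖ ≤ c * max ‖g x‖ 1 :=
                mul_le_mul (le_max_left _ _) (le_max_left _ _) (norm_nonneg _) hc0
              have e2 : c₂ ≤ c * max ‖g x‖ 1 := by
                calc c₂ ≤ c * 1 := by rw [mul_one]; exact le_max_right _ _
                  _ ≤ _ := by gcongr; exact le_max_right _ _
              exact add_le_add e1 e2
          _ = _ := by ring
      have h4 : max ‖g x‖ 1 ^ p x ≤ ‖g x‖ ^ p x + 1 := by
        have : 0 ≤ ‖g x‖ ^ p x := by positivity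
        rcases le_total ‖g x‖ 1 with h | h
        · rw [max_eq_right h, Real.one_rpow]; linarith
        · rw [max_eq_left h]; linarith
      rw [Real.norm_of_nonneg (by positivity)]
      calc ‖G x‖ ^ p x ≤ (2 * c * max ‖g x‖ 1) ^ p x :=
            Real.rpow_le_rpow (norm_nonneg _) h3 hp0
        _ = (2 * c) ^ p x * max ‖g x‖ 1 ^ p x := Real.mul_rpow (by positivity) hmax
        _ ≤ _ := by
          gcongr
          exact Real.rpow_le_max_one_rpow (by positivity) hp0 hx
  obtain ⟨hFGi, hFG⟩ := hv.integral_inner_eq_zero hp1 hL hM hF hb.le hFb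
    (fun r => hgp.integrableOn_isCompact (isCompact_closedBall _ _)) htest
    (fun x hx => by simp [hηz x hx]) hG0 hGp
  have hpt : ∀ᵐ x, a / 2 * (η x ^ (m + 1) * (u x ^ (2 * k) * ‖g x‖ ^ p x))
      - b * (m + 1) * D * (u x ^ (2 * k) * (|u x| * ‖∇ η x‖) ^ p x) ≤ inner ℝ (F x) (G x) := by
    filter_upwards [hM] with x hx
    have hp0 : 0 ≤ p x := by linarith [hp1 x]
    have hU : 0 ≤ u x ^ (2 * k) := by rw [pow_mul]; positivity
    have hY := Real.pow_mul_rpow_sub_one_mul_le (hη0 x) (hη1 x) (norm_nonneg (g x))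
      (by positivity : 0 ≤ |u x| * ‖∇ η x‖) hδ0 (hp1 x) (hx.trans (hm.trans (by linarith)))
    have hDle : δ ^ (1 - p x) ≤ D := by
      rw [← neg_sub, Real.rpow_neg hδ0.le, ← Real.inv_rpow hδ0.le]
      exact Real.rpow_le_max_one_rpow (by positivity) (by linarith [hp1 x]) (by linarith)
    set w := ‖g x‖ ^ p x with hw
    have hw0 : 0 ≤ w := by positivity
    set y := (|u x| * ‖∇ η x‖) ^ p x with hy
    have hy0 : 0 ≤ y := by positivity
    have hηm : 0 ≤ η x ^ m := pow_nonneg (hη0 x) m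
    have hηm1 : 0 ≤ η x ^ (m + 1) := pow_nonneg (hη0 x) _
    have e : inner ℝ (F x) (G x) = η x ^ (m + 1) * ((((2 * k : ℕ) : ℝ) + 1) * u x ^ (2 * k))
        * inner ℝ (F x) (g x)
        + u x ^ (2 * k) * ((m + 1) * η x ^ m) * (u x * inner ℝ (F x) (∇ η x)) := by
      simp only [hG, inner_add_right, real_inner_smul_right]
      ring
    have h1 : a * (η x ^ (m + 1) * (u x ^ (2 * k) * w)) ≤
        η x ^ (m + 1) * ((((2 * k : ℕ) : ℝ) + 1) * u x ^ (2 * k)) * inner ℝ (F x) (g x) := by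
      have hFx : a * w ≤ inner ℝ (F x) (g x) := hFa x
      -- The factor `2k + 1` only helps and is dropped.
      have hk : (1 : ℝ) ≤ ((2 * k : ℕ) : ℝ) + 1 := by linarith [((2 * k).cast_nonneg : (0 : ℝ) ≤ _)]
      have haw : 0 ≤ a * w := by positivity
      calc a * (η x ^ (m + 1) * (u x ^ (2 * k) * w))
          = η x ^ (m + 1) * (1 * u x ^ (2 * k)) * (a * w) := by ring
        _ ≤ _ := by gcongr
    have h2 : |u x * inner ℝ (F x) (∇ η x)| ≤
        b * (‖g x‖ ^ (p x - 1) * (|u x| * ‖∇ η x‖)) := by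
      rw [abs_mul]
      calc |u x| * |inner ℝ (F x) (∇ η x)| ≤ |u x| * (‖F x‖ * ‖∇ η x‖) := by
            gcongr; exact abs_real_inner_le_norm _ _
        _ ≤ |u x| * (b * ‖g x‖ ^ (p x - 1) * ‖∇ η x‖) := by gcongr; exact hFb x
        _ = _ := by ring
    have h3 : -(u x ^ (2 * k) * ((m + 1) * b) * (δ * (η x ^ (m + 1) * w) + D * y)) ≤
        u x ^ (2 * k) * ((m + 1) * η x ^ m) * (u x * inner ℝ (F x) (∇ η x)) := by
      have h4 : u x ^ (2 * k) * ((m + 1) * η x ^ m) * -(u x * inner ℝ (F x) (∇ η x)) ≤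
          u x ^ (2 * k) * ((m + 1) * b) * (δ * (η x ^ (m + 1) * w) + D * y) := by
        calc u x ^ (2 * k) * ((m + 1) * η x ^ m) * -(u x * inner ℝ (F x) (∇ η x))
            ≤ u x ^ (2 * k) * ((m + 1) * η x ^ m) *
              (b * (‖g x‖ ^ (p x - 1) * (|u x| * ‖∇ η x‖))) := by
              gcongr
              exact (neg_le_abs _).trans h2
          _ = u x ^ (2 * k) * ((m + 1) * b) *
              (η x ^ m * (‖g x‖ ^ (p x - 1) * (|u x| * ‖∇ η x‖))) := by ring
          _ ≤ u x ^ (2 * k) * ((m + 1) * b) * (δ * (η x ^ (m + 1) * w) + D * y) := by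
              gcongr
              exact hY.trans (by gcongr)
      linarith
    have h5 : u x ^ (2 * k) * ((m + 1) * b) * (δ * (η x ^ (m + 1) * w) + D * y)
        = a / 2 * (η x ^ (m + 1) * (u x ^ (2 * k) * w))
          + b * (m + 1) * D * (u x ^ (2 * k) * y) := by
      rw [← hδb]; ring
    rw [e]
    linarith
  have hint := integral_mono_ae ((hWi.const_mul (a / 2)).sub (hYi.const_mul (b * (m + 1) * D)))
    hFGi hpt
  rw [hFG] at hint
  simp only [Pi.sub_apply] at hint
  rw [integral_sub (hWi.const_mul _) (hYi.const_mul _), integral_const_mul,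
    integral_const_mul] at hint
  have := mul_le_mul_of_nonneg_left (sub_nonpos.1 hint) (by positivity : 0 ≤ 2 / a)
  calc _ = 2 / a * (a / 2 * ∫ x, η x ^ (m + 1) * (u x ^ (2 * k) * ‖g x‖ ^ p x)) := by
        field_simp
    _ ≤ _ := this
    _ = _ := by ring

/-- Smooth cutoff functions between concentric balls with gradient controlled by the radius. -/
theorem exists_cutoff (n : ℕ) : ∃ c : ℝ, 0 < c ∧ ∀ R : ℝ, 0 < R →
    ∃ η : EuclideanSpace ℝ (Fin n) → ℝ, ContDiff ℝ ∞ η ∧ (∀ x, 0 ≤ η x) ∧ (∀ x, η x ≤ 1) ∧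
      tsupport η ⊆ closedBall 0 (2 * R) ∧ (∀ x ∈ ball 0 R, η x = 1) ∧
      (∀ x, ‖∇ η x‖ ≤ c / R) ∧ ∀ x, x ∉ ball 0 (2 * R) \ ball 0 R → ∇ η x = 0 := by
  -- An outer radius below 2 keeps the closed support, after scaling, inside the open ball of radius
  -- `2 * R`.
  let f : ContDiffBump (0 : EuclideanSpace ℝ (Fin n)) := ⟨1, 3 / 2, one_pos, by norm_num⟩
  have hfs : ContDiff ℝ ∞ f := f.contDiff
  obtain ⟨c, hc⟩ := f.hasCompactSupport.gradient.exists_bound_of_continuous hfs.continuous_gradient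
  have hc0 : 0 ≤ c := (norm_nonneg _).trans (hc 0)
  refine ⟨c + 1, by positivity, fun R hR => ⟨fun x => f (R⁻¹ • x),
    hfs.comp (contDiff_const_smul _), fun x => f.nonneg, fun x => f.le_one, ?_, ?_, ?_, ?_⟩⟩
  all_goals
    have hnorm : ∀ x : EuclideanSpace ℝ (Fin n), ‖R⁻¹ • x‖ = ‖x‖ / R := fun x => by
      rw [norm_smul, norm_inv, Real.norm_of_nonneg hR.le, div_eq_inv_mul]
  · refine closure_minimal (fun x hx => ?_) isClosed_closedBall
    have h1 : R⁻¹ • x ∈ ball (0 : EuclideanSpace ℝ (Fin n)) f.rOut := by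
      rw [← f.support_eq]; exact hx
    rw [mem_ball_zero_iff, hnorm, div_lt_iff₀ hR] at h1
    have h2 : f.rOut = 3 / 2 := rfl
    rw [h2] at h1
    rw [mem_closedBall_zero_iff]
    linarith
  · intro x hx
    refine f.one_of_mem_closedBall ?_
    rw [mem_ball_zero_iff] at hx
    rw [mem_closedBall_zero_iff, hnorm, div_le_iff₀ hR]
    have h2 : f.rIn = 1 := rfl
    rw [h2]
    linarith
  all_goals
    have hgr : ∀ x, ∇ (fun x => f (R⁻¹ • x)) x = R⁻¹ • ∇ f (R⁻¹ • x) := fun x => by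
      refine ext_inner_right ℝ fun y => ?_
      rw [real_inner_smul_left, inner_gradient_left, inner_gradient_left, fderiv_comp_smul]
      simp
    intro x
    rw [hgr]
  · rw [norm_smul, norm_inv, Real.norm_of_nonneg hR.le, div_eq_inv_mul]
    have := hc (R⁻¹ • x)
    gcongr
    linarith
  · intro hx
    rw [Set.mem_sdiff, not_and_or, not_not] at hx
    rcases hx with hx | hx
    · rw [gradient_eq_zero_of_notMem_tsupport, smul_zero]
      rw [f.tsupport_eq, mem_closedBall_zero_iff, hnorm, div_le_iff₀ hR]
      have h2 : f.rOut = 3 / 2 := rfl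
      rw [mem_ball_zero_iff] at hx
      rw [h2]
      linarith
    · have h1 : (f : EuclideanSpace ℝ (Fin n) → ℝ) =ᶠ[𝓝 (R⁻¹ • x)] fun _ => (1 : ℝ) := by
        refine f.eventuallyEq_one_of_mem_ball ?_
        rw [mem_ball_zero_iff] at hx ⊢
        rw [hnorm, div_lt_iff₀ hR]
        have h2 : f.rIn = 1 := rfl
        rw [h2]
        linarith
      rw [h1.gradient_eq, gradient_fun_const, smul_zero]

/-- The integrand lives on the annulus, and `T ≤ 1` allows `T ^ p x` to be replaced by `T ^ P`. -/
theorem integral_pow_mul_rpow_le_of_growth {p : 𝔼 → ℝ} (hpm : Measurable p) (hp1 : ∀ x, 1 ≤ p x)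
    {M P : ℝ} (hM : ∀ᵐ x, p x ≤ M) (hP : ∀ᵐ x, P ≤ p x) {u η : 𝔼 → ℝ} (hu : Continuous u)
    (hη : ContDiff ℝ ∞ η) {R S T : ℝ} (hR : 0 < R) (hT : 0 < T) (hT1 : T ≤ 1)
    (hη0 : ∀ x, x ∉ ball (0 : 𝔼) (2 * R) \ ball 0 R → ∇ η x = 0)
    (huS : ∀ x ∈ ball (0 : 𝔼) (2 * R) \ ball 0 R, |u x| ≤ S)
    (huT : ∀ x ∈ ball (0 : 𝔼) (2 * R) \ ball 0 R, |u x| * ‖∇ η x‖ ≤ T) (hS : 0 ≤ S) (k : ℕ) :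
    ∫ x, u x ^ (2 * k) * (|u x| * ‖∇ η x‖) ^ p x ≤
      S ^ (2 * k) * T ^ P * (volume.real (closedBall (0 : 𝔼) 1) * 2 ^ n * R ^ n) := by
  have hB : volume.real (closedBall (0 : 𝔼) (2 * R))
      = volume.real (closedBall (0 : 𝔼) 1) * 2 ^ n * R ^ n := by
    rw [Measure.addHaar_real_closedBall' _ _ (by positivity), finrank_euclideanSpace,
      Fintype.card_fin, mul_pow]
    ring
  have hzero : ∀ x, x ∉ ball (0 : 𝔼) (2 * R) \ ball 0 R →
      u x ^ (2 * k) * (|u x| * ‖∇ η x‖) ^ p x = 0 := fun x hx => by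
    have : p x ≠ 0 := by linarith [hp1 x]
    simp [hη0 x hx, Real.zero_rpow this]
  have hi := integrable_pow_mul_rpow hpm hp1 hM hu hη (r := 2 * R)
    (fun x hx => hη0 x fun h => hx (ball_subset_closedBall h.1)) k
  have hI : Integrable ((closedBall (0 : 𝔼) (2 * R)).indicator fun _ => S ^ (2 * k) * T ^ P) :=
    IntegrableOn.integrable_indicator (integrableOn_const (measure_closedBall_lt_top.ne))
      measurableSet_closedBall
  refine (integral_mono_ae hi hI ?_).trans (le_of_eq ?_)
  · filter_upwards [hP] with x hx
    have hn : 0 ≤ S ^ (2 * k) * T ^ P := by positivity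
    by_cases hxA : x ∈ ball (0 : 𝔼) (2 * R) \ ball 0 R
    · rw [indicator_of_mem (ball_subset_closedBall hxA.1)]
      have h1 : u x ^ (2 * k) ≤ S ^ (2 * k) := by
        rw [pow_mul, ← sq_abs, ← pow_mul]
        exact pow_le_pow_left₀ (abs_nonneg _) (huS x hxA) _
      have h2 : (|u x| * ‖∇ η x‖) ^ p x ≤ T ^ P :=
        (Real.rpow_le_rpow (by positivity) (huT x hxA) (by linarith [hp1 x])).trans
          (Real.rpow_le_rpow_of_exponent_ge hT hT1 hx)
      exact mul_le_mul h1 h2 (by positivity) (by positivity)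
    · rw [hzero x hxA]
      exact indicator_nonneg (fun _ _ => hn) x
  · rw [integral_indicator measurableSet_closedBall, setIntegral_const, hB, smul_eq_mul]
    ring

theorem Real.rpow_le_two_rpow_abs_mul {s R α : ℝ} (hR : 0 < R) (h1 : R ≤ s) (h2 : s ≤ 2 * R) :
    s ^ α ≤ 2 ^ |α| * R ^ α := by
  have e : s = s / R * R := by field_simp
  have h3 : 1 ≤ s / R := (one_le_div hR).2 h1
  have h4 : s / R ≤ 2 := (div_le_iff₀ hR).2 h2
  rw [e, Real.mul_rpow (by linarith) hR.le]
  gcongr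
  exact (Real.rpow_le_rpow_of_exponent_le h3 (le_abs_self α)).trans
    (Real.rpow_le_rpow (by linarith) h4 (abs_nonneg α))

end Liouville

/-! ### The Liouville theorem. -/

theorem corollary3p7 {n : ℕ}
    (p : EuclideanSpace ℝ (Fin n) → ℝ) (hp : IsLogHolderExponent p)
    (A : EuclideanSpace ℝ (Fin n) → ℝ → EuclideanSpace ℝ (Fin n) → EuclideanSpace ℝ (Fin n))
    (hA : HasNonstandardGrowth p A)
    (u : EuclideanSpace ℝ (Fin n) → ℝ) (hu : IsAHarmonic p A u)
    (C : ℝ) (hC : 0 < C)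
    (α : ℝ) (hα : α < expInf p / expSup p - (n : ℝ) / expSup p)
    (R : ℕ → ℝ) (hRmono : Monotone R) (hRunbdd : ¬ BddAbove (Set.range R))
    (hgrowth : ∃ k₀ : ℕ, 1 < R k₀ ∧ ∀ k, k₀ ≤ k →
      ∀ x ∈ Metric.ball (0 : EuclideanSpace ℝ (Fin n)) (2 * R k) \ Metric.ball 0 (R k),
        |u x| ≤ C * ‖x‖ ^ α) :
    ∃ c : ℝ, ∀ x, u x = c := by
  obtain ⟨hpm, hp1, hL, ⟨M, hM⟩, hP1⟩ := hp
  obtain ⟨hcar, a', b', -, -, ⟨a, ha, haa⟩, ⟨b, hbb⟩, hab, hAa, hAb⟩ := hA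
  obtain ⟨huc, g, hW, htest⟩ := hu
  have hb : 0 < b := ha.trans_le (((haa 0).trans (hab 0)).trans (hbb 0))
  have hgr := hW.grad
  have hFm : AEStronglyMeasurable fun x => A x (u x) (g x) :=
    hcar.aestronglyMeasurable_comp huc.aestronglyMeasurable hgr.locInt_grad.aestronglyMeasurable
  have hgp : LocallyIntegrable fun x => ‖g x‖ ^ p x :=
    locallyIntegrable_iff.2 fun K hK => (hW.memLp_grad K hK).integrableOn_rpow hpm hp1 hM
  have hFa : ∀ x, a * ‖g x‖ ^ p x ≤ inner ℝ (A x (u x) (g x)) (g x) := fun x =>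
    (mul_le_mul_of_nonneg_right (haa x) (by positivity)).trans (hAa x _ _)
  have hFb : ∀ x, ‖A x (u x) (g x)‖ ≤ b * ‖g x‖ ^ (p x - 1) := fun x =>
    (hAb x _ _).trans (mul_le_mul_of_nonneg_right (hbb x) (by positivity))
  have hPae : ∀ᵐ x, expInf p ≤ p x := ae_essInf_le (isBoundedUnder_of ⟨1, hp1⟩)
  have hQae : ∀ᵐ x, p x ≤ expSup p := ae_le_essSup ⟨M, hM⟩
  set P := expInf p with hP
  set Q := expSup p with hQ
  obtain ⟨x₀, hx₀P, hx₀Q⟩ := (hPae.and hQae).exists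
  have hQ0 : 0 < Q := by linarith [hp1 x₀]
  have hPQ : P ≤ Q := hx₀P.trans hx₀Q
  have hP0 : 0 < P := one_pos.trans hP1
  have hαQ : α * Q < P - n := by
    rwa [← sub_div, lt_div_iff₀ hQ0] at hα
  have hn0 : (0 : ℝ) ≤ n := n.cast_nonneg
  have hα1 : α < 1 := by
    by_contra! h
    nlinarith
  -- If `α ≥ 0`, then `α * P ≤ α * Q < P - n` and `k = 0` works; if `α < 0`, the term `2 * k * α`
  -- dominates for large `k`.
  obtain ⟨k, hk⟩ : ∃ k : ℕ, 2 * k * α + (α - 1) * P + n < 0 := by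
    rcases le_or_gt 0 α with h | h
    · exact ⟨0, by push_cast; nlinarith⟩
    · obtain ⟨k, hk⟩ := exists_nat_gt (((α - 1) * P + n) / (-(2 * α)))
      rw [div_lt_iff₀ (by linarith)] at hk
      exact ⟨k, by nlinarith⟩
  obtain ⟨K, hK0, m, hK⟩ := exists_integral_pow_mul_rpow_le hpm hp1 hL hM hFm ha hb hFa hFb hgp
    htest huc hgr k
  obtain ⟨c, hc0, hcut⟩ := exists_cutoff n
  obtain ⟨k₀, -, hgrow⟩ := hgrowth
  have hRlim : Tendsto R atTop atTop := tendsto_atTop_atTop_of_monotone' hRmono hRunbdd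
  set C₁ := C * 2 ^ |α| with hC₁
  have hC₁0 : 0 < C₁ := by positivity
  set V := K * (C₁ ^ (2 * k) * (C₁ * c) ^ P *
      (volume.real (closedBall (0 : EuclideanSpace ℝ (Fin n)) 1) * 2 ^ n))
    with hV
  have hT : Tendsto (fun j => C₁ * c * R j ^ (α - 1)) atTop (𝓝 0) := by
    have := (tendsto_rpow_neg_atTop (y := 1 - α) (by linarith)).comp hRlim
    simpa [Function.comp_def] using this.const_mul (C₁ * c)
  have hlim : Tendsto (fun j => V * R j ^ (2 * k * α + (α - 1) * P + n)) atTop (𝓝 0) := by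
    have := (tendsto_rpow_neg_atTop (y := -(2 * k * α + (α - 1) * P + n)) (by linarith)).comp hRlim
    simpa only [Function.comp_def, neg_neg, mul_zero] using this.const_mul V
  have hWloc : LocallyIntegrable fun x => u x ^ (2 * k) * ‖g x‖ ^ p x :=
    hgp.continuous_smul (huc.pow _)
  have hnn : ∀ x, 0 ≤ u x ^ (2 * k) * ‖g x‖ ^ p x := fun x => by rw [pow_mul]; positivity
  -- For fixed `r`, the integral is bounded by `V` times a negative power of `R j` for all large
  -- `j`.
  have hsmall : ∀ r : ℝ,
      ∫ x in ball (0 : EuclideanSpace ℝ (Fin n)) r, u x ^ (2 * k) * ‖g x‖ ^ p x ≤ 0 := by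
    intro r
    refine ge_of_tendsto hlim ?_
    filter_upwards [hRlim.eventually_ge_atTop r, hRlim.eventually_gt_atTop 0,
      hT.eventually (gt_mem_nhds one_pos), eventually_ge_atTop k₀] with j hjr hj0 hjT hjk
    obtain ⟨η, hη, hη0, hη1, hηs, hηR, hηc, hηz⟩ := hcut (R j) hj0
    obtain ⟨hi, hle⟩ := hK η (2 * R j) hη hη0 hη1 hηs
    have hann : ∀ x ∈ ball (0 : EuclideanSpace ℝ (Fin n)) (2 * R j) \ ball 0 (R j),
        |u x| ≤ C₁ * R j ^ α := by
      intro x hx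
      refine (hgrow j hjk x hx).trans ?_
      rw [hC₁, mul_assoc]
      gcongr
      have h1 := hx.1
      have h2 := hx.2
      rw [mem_ball_zero_iff] at h1 h2
      exact Real.rpow_le_two_rpow_abs_mul hj0 (not_lt.1 h2) h1.le
    have hbd := integral_pow_mul_rpow_le_of_growth hpm hp1 hM hPae huc hη hj0
      (S := C₁ * R j ^ α) (T := C₁ * c * R j ^ (α - 1)) (by positivity) hjT.le hηz hann
      (fun x hx => by
        calc |u x| * ‖∇ η x‖ ≤ (C₁ * R j ^ α) * (c / R j) := by
              gcongr
              · exact hann x hx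
              · exact hηc x
          _ = _ := by rw [Real.rpow_sub_one hj0.ne']; ring) (by positivity) k
    have hpowers : (R j ^ α) ^ (2 * k) * (R j ^ (α - 1)) ^ P * R j ^ n
        = R j ^ (2 * k * α + (α - 1) * P + n) := by
      rw [← Real.rpow_natCast (R j ^ α), ← Real.rpow_natCast (R j) n, ← Real.rpow_mul hj0.le,
        ← Real.rpow_mul hj0.le, ← Real.rpow_add hj0, ← Real.rpow_add hj0]
      congr 1
      push_cast
      ring
    calc ∫ x in ball (0 : EuclideanSpace ℝ (Fin n)) r, u x ^ (2 * k) * ‖g x‖ ^ p x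
        ≤ ∫ x, η x ^ (m + 1) * (u x ^ (2 * k) * ‖g x‖ ^ p x) := by
          rw [← integral_indicator measurableSet_ball]
          refine integral_mono ?_ hi fun x => ?_
          · exact ((hWloc.integrableOn_isCompact (isCompact_closedBall 0 r)).mono_set
              ball_subset_closedBall).integrable_indicator measurableSet_ball
          · by_cases hx : x ∈ ball (0 : EuclideanSpace ℝ (Fin n)) r
            · simp only [indicator_of_mem hx, hηR x (ball_subset_ball hjr hx), one_pow, one_mul]
              exact le_rfl
            · rw [indicator_of_notMem hx]
              exact mul_nonneg (pow_nonneg (hη0 x) _) (hnn x)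
      _ ≤ K * ∫ x, u x ^ (2 * k) * (|u x| * ‖∇ η x‖) ^ p x := hle
      _ ≤ K * ((C₁ * R j ^ α) ^ (2 * k) * (C₁ * c * R j ^ (α - 1)) ^ P *
          (volume.real (closedBall (0 : EuclideanSpace ℝ (Fin n)) 1) * 2 ^ n * R j ^ n)) := by
          gcongr
      _ = V * ((R j ^ α) ^ (2 * k) * (R j ^ (α - 1)) ^ P * R j ^ n) := by
          rw [mul_pow, Real.mul_rpow (by positivity) (by positivity), hV]
          ring
      _ = _ := by rw [hpowers]
  have hae : ∀ᵐ x, u x ^ (2 * k) * ‖g x‖ ^ p x = 0 := by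
    have hN : ∀ N : ℕ, ∀ᵐ x, x ∈ ball (0 : EuclideanSpace ℝ (Fin n)) N →
        u x ^ (2 * k) * ‖g x‖ ^ p x = 0 := fun N => by
      rw [← ae_restrict_iff' measurableSet_ball]
      refine (integral_eq_zero_iff_of_nonneg hnn ?_).1
        (le_antisymm (hsmall N) (integral_nonneg hnn))
      exact (hWloc.integrableOn_isCompact (isCompact_closedBall 0 (N : ℝ))).mono_set
        ball_subset_closedBall
    filter_upwards [ae_all_iff.2 hN] with x hx
    obtain ⟨N, hN⟩ := exists_nat_gt ‖x‖
    exact hx N (by rwa [mem_ball_zero_iff])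
  -- This is the gradient of `u ^ (2 * k + 1)`; it vanishes where `u ^ (2 * k) = 0` without any
  -- claim on `g` there.
  have hg0 : (fun x => ((((2 * k : ℕ) : ℝ) + 1) * u x ^ (2 * k)) • g x) =ᵐ[volume] 0 := by
    filter_upwards [hae] with x hx
    rcases mul_eq_zero.1 hx with h | h
    · simp [h]
    · have : p x ≠ 0 := by linarith [hp1 x]
      rw [Real.rpow_eq_zero (norm_nonneg _) this, norm_eq_zero] at h
      simp [h]
  refine ⟨u 0, fun x => ?_⟩
  exact (Odd.strictMono_pow ⟨k, rfl⟩).injective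
    ((hgr.pow huc (2 * k)).eq_const_of_eq_zero (huc.pow _) hg0 x 0)
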